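/- Let $G$ be a finite 2-connected simple graph on $n$ vertices, i.e. $n>2$ and $G$ has no separation of order at most 1. Here a separation is a pair $(A,B)$ with $A\cup B=V(G)$, $A\setminus B$ and $B\setminus A$ nonempty, and no edge between $A\setminus B$ and $B\setminus A$; its separator is $A\cap B$ and its order is $|A\cap B|$. A 2-separation is a separation of order 2. Two separations $(A,B)$, $(C,D)$ are nested if, after possibly switching $A,B$ and possibly switching $C,D$, we have $A\subseteq C$ and $D\subseteq B$; otherwise they cross. A 2-separation is crossed if some 2-separation of $G$ crosses it. It is half-connected if $G[A\setminus B]$ or $G[B\setminus A]$ is connected. It separates two vertices if one of them lies in $A\setminus B$ and the other in $B\setminus A$. Let $T$ be a normal spanning tree of $G$ with root $r$, i.e. a spanning tree such that the endpoints of every edge of $G$ are comparable in the tree order of $T$ (ancestors and descendants are not necessarily proper). Write $p(v)$ for the parent of $v\ne r$, $\mathrm{Desc}(v)$ for the set of descendants of $v$, $T[u,v]$ for the path of $T$ between $u$ and $v$, and $T(u,v)$ for $T[u,v]$ without $u$ and $v$. A leaf is a vertex without children. Edges of $G$ not in $T$ are back-edges, written $(x,y)$ with $x$ a descendant of $y$.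 Let $L(v)$ be the set of proper ancestors of $v$ adjacent in $G$ to a descendant of $v$. Let $lwpt_k(v)$ be the $k$-th lowest element of $L(v)$ (lowest means closest to $r$) if $|L(v)|\ge k$, and $v$ otherwise; $lwpt=lwpt_1$. Let $hgpt(v)$ be the highest element of $L(v)\setminus\{p(v)\}$ if this set is nonempty, and $v$ otherwise. Suppose that the vertices are numbered by $1,\dots,n$ and identified with their numbers, and that the numbering is compatible with $T$: the descendants of $j$ form exactly the interval $[j,\,j+|\mathrm{Desc}(j)|-1]$, and if $j<k$ are siblings then $(-lwpt_1(j),lwpt_2(j))\le_{lex}(-lwpt_1(k),lwpt_2(k))$. The left child of a non-leaf $v$ is its largest child; a leftmost descendant of $v$ is a vertex obtained from $v$ by going to the left child zero or more times. $T[a,b]$ is a leftmost path if $b$ is a leftmost descendant of some child $a'$ of $a$; it is stable if it is a leftmost path and every back-edge $(x,y)$ with $a'\le x<b$ satisfies $y\ge a$. Let $stab(a,b)$ be the largest ancestor $x$ of $a$ such that $T[x,b]$ is stable, and $0$ if there is none. If $b\ne r$ is not a leaf and $\ell$ is its left child, let $\alpha(b)=stab(p(b),\ell)$, and let $\beta(b)$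 be the smallest leftmost descendant $x$ of $\ell$ such that $x$ is a leaf or the left child $c$ of $x$ satisfies $lwpt(c)\ge b$ or $hgpt(c)<b$. If $b=r$ or $b$ is a leaf, let $\alpha(b)=\beta(b)=0$. A 2-separation $(A,B)$ with separator $\{a,b\}$ is type-2 if $r\notin\{a,b\}$, $T(a,b)$ is nonempty and, up to exchanging $A$ and $B$, $r\in A\setminus B$ and $T(a,b)\subseteq B\setminus A$. Let $(A,B)$ be a half-connected type-2 separation of $G$ with separator $\{a<b\}$. Then there is a unique child $a'$ of $a$ that is an ancestor of $b$, and $(A,B)$ is crossed if and only if at least one of the following holds. (i) There exists $\gamma\in T(a,b)$ whose left child $\ell'$ satisfies $lwpt_2(\ell')=\gamma$. (ii) There exists $\gamma\in T(a,b)$ whose left child $\ell'$ satisfies $hgpt(\ell')\le stab(p(a),a')$. (iii) $b$ is not a leaf of $T$ and, with $\ell$ the left child of $b$, $\alpha=\alpha(b)$ and $\beta=\beta(b)$: $(A,B)$ does not separate $\ell$ and $r$, $\alpha>a$, every child $c$ of $\beta$ satisfies $lwpt(c)\ge\alpha$ or $hgpt(c)\le\alpha$, and $T[\alpha,\beta]$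 is stable. -/

import Mathlib

noncomputable section

namespace TutteSep

/-! ### Separations of a graph -/

section Separations

variable {V : Type*} (G : SimpleGraph V)

/-- `(A, B)` is a separation of `G`. -/
structure IsSeparation (A B : Set V) : Prop where
  union_eq : A ∪ B = Set.univ
  left_nonempty : (A \ B).Nonempty
  right_nonempty : (B \ A).Nonempty
  not_adj : ∀ x ∈ A \ B, ∀ y ∈ B \ A, ¬ G.Adj x y

/-- A separation whose separator has exactly two vertices. -/
def IsTwoSeparation (A B : Set V) : Prop :=
  IsSeparation G A B ∧ (A ∩ B).ncard = 2

/-- `k`-connectedness: more than `k` vertices and no separation of order less than `k`. -/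
def IsKConnected (k : ℕ) : Prop :=
  k < Nat.card V ∧ ∀ A B : Set V, IsSeparation G A B → ¬ (A ∩ B).ncard < k

/-- `(A, B)` and `(C, D)` are nested: after possibly switching `A` and `B`, and possibly
switching `C` and `D`, one has `A ⊆ C` and `D ⊆ B`. -/
def Nested (A B C D : Set V) : Prop :=
  (A ⊆ C ∧ D ⊆ B) ∨ (B ⊆ C ∧ D ⊆ A) ∨ (A ⊆ D ∧ C ⊆ B) ∨ (B ⊆ D ∧ C ⊆ A)

/-- `(A, B)` is crossed by some 2-separation of `G`. -/
def IsCrossed (A B : Set V) : Prop :=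
  ∃ C D : Set V, IsTwoSeparation G C D ∧ ¬ Nested A B C D

/-- One of the two sides `A \ B`, `B \ A` induces a connected subgraph. -/
def IsHalfConnected (A B : Set V) : Prop :=
  (G.induce (A \ B)).Connected ∨ (G.induce (B \ A)).Connected

/-- `(A, B)` separates the vertices `x` and `y`. -/
def Separates (A B : Set V) (x y : V) : Prop :=
  (x ∈ A \ B ∧ y ∈ B \ A) ∨ (y ∈ A \ B ∧ x ∈ B \ A)

end Separations

/-! ### Rooted trees -/

section RootedTree

variable {V : Type*} (T : SimpleGraph V) (r : V)

/-- The vertex set of the path `T[u, v]` between `u` and `v` in the tree `T`. -/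
def treePath (u v : V) : Set V :=
  {w | ∃ p : T.Walk u v, p.IsPath ∧ w ∈ p.support}

/-- The vertex set of `T(u, v)`, the path without its two ends. -/
def openTreePath (u v : V) : Set V :=
  treePath T u v \ {u, v}

/-- `u` is a (not necessarily proper) ancestor of `v`. -/
def IsAncestor (u v : V) : Prop :=
  u ∈ treePath T r v

/-- The set of (not necessarily proper) descendants of `v`. -/
def Desc (v : V) : Set V :=
  {u | IsAncestor T r v u}

/-- `c` is a child of `v`, that is, `v` is the parent of `c`. -/
def IsChild (c v : V) : Prop :=
  T.Adj v c ∧ IsAncestor T r v c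

open Classical in
/-- The parent `p(v)` of `v` (with the junk value `v` if `v` is the root). -/
def parent (v : V) : V :=
  if h : ∃ u, IsChild T r v u then h.choose else v

/-- `v` is a leaf of the rooted tree: it has no child. -/
def IsLeaf (v : V) : Prop :=
  ∀ c, ¬ IsChild T r c v

end RootedTree

/-! ### Normal spanning trees, lowpoints and highpoints -/

section Lowpoints

variable {V : Type*} (G T : SimpleGraph V) (r : V)

/-- `T`, rooted at `r`, is a normal spanning tree of `G`. -/
structure IsNormalSpanningTree : Prop where
  le : T ≤ G
  isTree : T.IsTree
  comparable : ∀ u v, G.Adj u v → IsAncestor T r u v ∨ IsAncestor T r v u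

/-- `(x, y)` is a back-edge, where `x` is the descendant and `y` the ancestor. -/
def IsBackEdge (x y : V) : Prop :=
  G.Adj x y ∧ ¬ T.Adj x y ∧ IsAncestor T r y x

/-- `L(v)`: the proper ancestors of `v` that are adjacent in `G` to a descendant of `v`. -/
def lowSet (v : V) : Set V :=
  {u | IsAncestor T r u v ∧ u ≠ v ∧ ∃ d ∈ Desc T r v, G.Adj d u}

open Classical in
/-- The `k`-th lowpoint of `v` (for `k ≥ 1`): the `k`-th lowest element of `L(v)`, that is,
the `w ∈ L(v)` having exactly `k` ancestors in `L(v)` (itself included), or `v` if `L(v)` has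
fewer than `k` elements. -/
def lwpt (k : ℕ) (v : V) : V :=
  if h : ∃ w ∈ lowSet G T r v, {u ∈ lowSet G T r v | IsAncestor T r u w}.ncard = k
  then h.choose else v

open Classical in
/-- The highpoint of `v`: the highest element of `L(v) \ {p(v)}`, or `v` if this set is empty. -/
def hgpt (v : V) : V :=
  if h : ∃ w ∈ lowSet G T r v \ {parent T r v},
      ∀ u ∈ lowSet G T r v \ {parent T r v}, IsAncestor T r u w
  then h.choose else v

end Lowpoints

/-! ### Numberings, leftmost paths and stability -/

section Numbering

variable {V : Type*} (G T : SimpleGraph V) (r : V) (num : V → ℕ)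

/-- The ordering `≤'` on pairs of numbers: `(x, y) ≤' (x', y')` iff `(-x, y) ≤ (-x', y')`
lexicographically. -/
def pairLE (p q : ℕ × ℕ) : Prop :=
  toLex (-(p.1 : ℤ), (p.2 : ℤ)) ≤ toLex (-(q.1 : ℤ), (q.2 : ℤ))

/-- The numbering `num` of the vertices is compatible with the normal spanning tree `T`. -/
structure IsCompatible : Prop where
  bijOn : Set.BijOn num Set.univ (Set.Icc 1 (Nat.card V))
  desc_interval : ∀ v, num '' Desc T r v =
    Set.Icc (num v) (num v + (Desc T r v).ncard - 1)
  siblings : ∀ v j k, IsChild T r j v → IsChild T r k v → num j < num k →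
    pairLE (num (lwpt G T r 1 j), num (lwpt G T r 2 j))
      (num (lwpt G T r 1 k), num (lwpt G T r 2 k))

/-- `c` is the left child of `v`: its child with the largest number. -/
def IsLeftChild (c v : V) : Prop :=
  IsChild T r c v ∧ ∀ c', IsChild T r c' v → num c' ≤ num c

open Classical in
/-- The left child `ℓ(v)` of `v` (with the junk value `v` if `v` is a leaf). -/
def leftChild (v : V) : V :=
  if h : ∃ c, IsLeftChild T r num c v then h.choose else v

/-- `w` is a (not necessarily proper) leftmost descendant of `v`: it is reached from `v` by
repeatedly going to the left child. -/
def IsLeftmostDesc (w v : V) : Prop :=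
  Relation.ReflTransGen (fun x y => IsLeftChild T r num y x) v w

/-- `T[a, b]` is a leftmost path and is stable. -/
def IsStable (a b : V) : Prop :=
  ∃ a', IsChild T r a' a ∧ IsLeftmostDesc T r num b a' ∧
    ∀ x y, IsBackEdge G T r x y → num a' ≤ num x → num x < num b → num a ≤ num y

/-- `stab(a, b)`: the largest (number of an) ancestor `x` of `a` such that `T[x, b]` is stable,
and `0` if there is none (`sSup ∅ = 0`). -/
def stab (a b : V) : ℕ :=
  sSup {s | ∃ x, IsAncestor T r x a ∧ IsStable G T r num x b ∧ num x = s}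

open Classical in
/-- `α(b) = stab(p(b), ℓ(b))` if `b` is neither the root nor a leaf, and `0` otherwise. -/
def alpha (b : V) : ℕ :=
  if b = r ∨ IsLeaf T r b then 0 else stab G T r num (parent T r b) (leftChild T r num b)

open Classical in
/-- `β(b)`: if `b` is neither the root nor a leaf, the (number of the) smallest leftmost
descendant `x` of `ℓ(b)` such that `x` is a leaf or the left child `c` of `x` satisfies
`lwpt(c) ≥ b` or `hgpt(c) < b`; and `0` otherwise. -/
def beta (b : V) : ℕ :=
  if b = r ∨ IsLeaf T r b then 0 else
    sInf {s | ∃ x, num x = s ∧ IsLeftmostDesc T r num x (leftChild T r num b) ∧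
      (IsLeaf T r x ∨ ∃ c, IsLeftChild T r num c x ∧
        (num b ≤ num (lwpt G T r 1 c) ∨ num (hgpt G T r c) < num b))}

/-- For a separation `(A, B)` with separator `{a, b}`: the separation is type-2. -/
def IsTypeTwo (A B : Set V) (a b : V) : Prop :=
  r ∉ ({a, b} : Set V) ∧ (openTreePath T a b).Nonempty ∧
    ((r ∈ A \ B ∧ openTreePath T a b ⊆ B \ A) ∨
      (r ∈ B \ A ∧ openTreePath T a b ⊆ A \ B))

end Numbering

end TutteSep

end

open TutteSep

/-!
A 2-separation `(A, B)` with separator `{a, b}` and a connected side is crossed exactly by the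
2-separations whose separator has one vertex `c` strictly in `A` and one vertex `d` strictly in
`B`; these automatically separate `a` from `b` (`exists_crossing`, `isCrossed_of_closed`). So the
question is whether some such pair `{c, d}` cuts `a` off from `b`.

Let the root lie in `A \ B`. Since the separation is type-2, `a` is an ancestor of `b` and `d` must
be a vertex `γ` of the tree path `T(a, b)`. By 2-connectedness some descendant of `b` has a
neighbour above `a`, while nothing else below `a'` does; as siblings are numbered by decreasing
lowpoint, `T[a', b]` is therefore a leftmost path. The paths `T[c, a']` and `T[γ, c]` below are
leftmost for the same reason (`isLeftmostDesc_of_noEscape`). Since the descendants of a vertex are numbered consecutively,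
with leftmost descendants last, stability of a leftmost path `T[u, w]` with `u'` the child of `u`
on it says that no edge leads from a vertex below `u'` but not below `w` to a proper ancestor of
`u` (`NoEscape`).

* If `c` is a proper ancestor of `a` (`exists_of_separator_above`), let `ℓ` be the left child of
  `γ`. Then `L(ℓ)` has no element strictly between `c` and `γ`. Either `L(ℓ) = {c, γ}`, which is
  the first condition, or the subtree below `ℓ` reaches above `c`; then the part of the tree between
  `c` and `γ` does not, so `T[c, a']` is stable and `hgpt(ℓ) ≤ c ≤ stab(p(a), a')`, which is
  the second condition.
* Otherwise `c` is a proper descendant of `b` (`exists_of_separator_below`): `T[γ, c]` is stable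
  and no subtree below a child of `c` is attached both to the part between `γ` and `c` and
  above `γ`. As the left child `ℓ` of `b` is strictly in `A`, its subtree has no neighbours in
  `T(a, b)`, and `{γ, c}` can be replaced by `{α(b), β(b)}` (`exists_alpha_beta`), which
  gives the third condition.

Conversely, each condition exhibits a vertex set that is cut off by the pair in question
(`isCrossed_of_lwpt_two`, `isCrossed_of_hgpt_le`, `isCrossed_of_stable`).
-/

open TutteSep
namespace TutteSep

/-! ### The tree order -/

section TreeOrder

variable {V : Type*} {T : SimpleGraph V} {r u v w x y c : V}

theorem isAncestor_iff_mem_support (hT : T.IsTree) {p : T.Walk r v} (hp : p.IsPath) :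
    IsAncestor T r u v ↔ u ∈ p.support := by
  refine ⟨fun ⟨q, hq, hu⟩ => ?_, fun hu => ⟨p, hp, hu⟩⟩
  rwa [(hT.existsUnique_path r v).unique hp hq]

theorem exists_isPath (hT : T.IsTree) (u v : V) : ∃ p : T.Walk u v, p.IsPath :=
  (hT.existsUnique_path u v).exists

theorem IsAncestor.refl (hT : T.IsTree) (v : V) : IsAncestor T r v v := by
  obtain ⟨p, hp⟩ := exists_isPath hT r v
  exact ⟨p, hp, p.end_mem_support⟩

theorem root_isAncestor (hT : T.IsTree) (v : V) : IsAncestor T r r v := by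
  obtain ⟨p, hp⟩ := exists_isPath hT r v
  exact ⟨p, hp, p.start_mem_support⟩

theorem IsAncestor.trans (hT : T.IsTree) (huv : IsAncestor T r u v) (hvw : IsAncestor T r v w) :
    IsAncestor T r u w := by
  classical
  obtain ⟨p, hp, hv⟩ := hvw
  rw [isAncestor_iff_mem_support hT (hp.takeUntil hv)] at huv
  exact ⟨p, hp, p.support_takeUntil_subset_support hv huv⟩

theorem IsAncestor.antisymm (hT : T.IsTree) (huv : IsAncestor T r u v)
    (hvu : IsAncestor T r v u) : u = v := by
  classical
  by_contra hne
  obtain ⟨p, hp, hu⟩ := huv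
  have hv := (isAncestor_iff_mem_support hT (hp.takeUntil hu)).1 hvu
  have h := (hT.existsUnique_path r v).unique hp ((hp.takeUntil hu).takeUntil hv)
  have h1 := SimpleGraph.Walk.length_takeUntil_lt_length hu hne
  have h2 := (p.takeUntil u hu).length_takeUntil_le_length hv
  rw [← h] at h2
  omega

theorem IsChild.ne (h : IsChild T r c u) : c ≠ u := h.1.ne'

theorem isChild_or_isChild_of_adj (hT : T.IsTree) (h : T.Adj u v) :
    IsChild T r v u ∨ IsChild T r u v := by
  obtain ⟨p, hp⟩ := exists_isPath hT r u
  by_cases hv : v ∈ p.support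
  · exact Or.inr ⟨h.symm, p, hp, hv⟩
  · exact Or.inl ⟨h, p.concat h, hp.concat hv h, by simp [SimpleGraph.Walk.support_concat]⟩

/-- The root path of a child is the root path of its parent, prolonged by one vertex. -/
theorem IsChild.isAncestor_iff (hT : T.IsTree) (h : IsChild T r c u) :
    IsAncestor T r x c ↔ IsAncestor T r x u ∨ x = c := by
  obtain ⟨p, hp⟩ := exists_isPath hT r u
  have hc : c ∉ p.support := fun hc =>
    h.ne (IsAncestor.antisymm hT ⟨p, hp, hc⟩ h.2)
  rw [isAncestor_iff_mem_support hT hp, isAncestor_iff_mem_support hT (hp.concat hc h.1)]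
  simp [SimpleGraph.Walk.support_concat]

theorem exists_isChild_of_ne_root (hT : T.IsTree) (hv : v ≠ r) : ∃ u, IsChild T r v u := by
  obtain ⟨p, hp⟩ := exists_isPath hT r v
  have hnil : ¬ p.Nil := SimpleGraph.Walk.not_nil_of_ne hv.symm
  exact ⟨p.penultimate, p.adj_penultimate hnil, p, hp, p.getVert_mem_support _⟩

theorem eq_root_of_isAncestor_root (hT : T.IsTree) (h : IsAncestor T r u r) : u = r :=
  h.antisymm hT (root_isAncestor hT u)

theorem tree_induction (hT : T.IsTree) {P : V → Prop} (hr : P r)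
    (hc : ∀ c u, IsChild T r c u → P u → P c) (v : V) : P v := by
  classical
  have key : ∀ n : ℕ, ∀ v, ∀ p : T.Walk r v, p.IsPath → p.length = n → P v := by
    intro n
    induction n using Nat.strong_induction_on with
    | _ n ih =>
      intro v p hp hn
      by_cases hv : v = r
      · exact hv ▸ hr
      obtain ⟨u, hu⟩ := exists_isChild_of_ne_root (r := r) hT hv
      have hup := (isAncestor_iff_mem_support hT hp).1 hu.2
      exact hc v u hu (ih _ (hn ▸ SimpleGraph.Walk.length_takeUntil_lt_length hup hu.ne.symm) u
        (p.takeUntil u hup) (hp.takeUntil hup) rfl)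
  obtain ⟨p, hp⟩ := exists_isPath hT r v
  exact key _ v p hp rfl

theorem IsAncestor.total (hT : T.IsTree) (hu : IsAncestor T r u w) (hv : IsAncestor T r v w) :
    IsAncestor T r u v ∨ IsAncestor T r v u := by
  induction w using tree_induction (r := r) hT with
  | hr => exact Or.inr (eq_root_of_isAncestor_root hT hv ▸ root_isAncestor hT u)
  | hc c p hc ih =>
    rcases (hc.isAncestor_iff hT).1 hu with hu' | rfl
    · rcases (hc.isAncestor_iff hT).1 hv with hv' | rfl
      · exact ih hu' hv'
      · exact Or.inl hu
    · exact Or.inr hv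

theorem exists_isChild_isAncestor (hT : T.IsTree) (h : IsAncestor T r u w) (hne : u ≠ w) :
    ∃ c, IsChild T r c u ∧ IsAncestor T r c w := by
  induction w using tree_induction (r := r) hT with
  | hr => exact absurd (eq_root_of_isAncestor_root hT h) hne
  | hc c p hc ih =>
    rcases (hc.isAncestor_iff hT).1 h with h' | rfl
    · by_cases hup : u = p
      · exact ⟨c, hup ▸ hc, .refl hT c⟩
      · obtain ⟨d, hd, hdp⟩ := ih h' hup
        exact ⟨d, hd, hdp.trans hT hc.2⟩
    · exact absurd rfl hne

theorem IsChild.not_isAncestor (hT : T.IsTree) (h : IsChild T r c u) : ¬ IsAncestor T r c u :=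
  fun h' => h.ne (h'.antisymm hT h.2)

theorem IsChild.eq_of_isAncestor (hT : T.IsTree) (hc : IsChild T r c u) (hx : IsChild T r x u)
    (h : IsAncestor T r c x) : c = x :=
  ((hx.isAncestor_iff hT).1 h).resolve_left (hc.not_isAncestor hT)

theorem IsChild.unique (hT : T.IsTree) (hc : IsChild T r c u) (hx : IsChild T r x u)
    (hcw : IsAncestor T r c w) (hxw : IsAncestor T r x w) : c = x := by
  rcases hcw.total hT hxw with h | h
  · exact hc.eq_of_isAncestor hT hx h
  · exact (hx.eq_of_isAncestor hT hc h).symm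

theorem IsChild.parent_unique (hT : T.IsTree) (hu : IsChild T r c u) (hv : IsChild T r c v) :
    u = v :=
  (((hv.isAncestor_iff hT).1 hu.2).resolve_right hu.ne.symm).antisymm hT
    (((hu.isAncestor_iff hT).1 hv.2).resolve_right hv.ne.symm)

theorem IsChild.parent_eq (hT : T.IsTree) (h : IsChild T r c u) : parent T r c = u := by
  have hex : ∃ u, IsChild T r c u := ⟨u, h⟩
  rw [parent, dif_pos hex]
  exact hex.choose_spec.parent_unique hT h

theorem IsChild.ne_root (hT : T.IsTree) (h : IsChild T r c u) : c ≠ r := by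
  rintro rfl
  exact h.not_isAncestor hT (root_isAncestor hT u)

theorem mem_treePath_iff (hT : T.IsTree) (h : IsAncestor T r u w) :
    x ∈ treePath T u w ↔ IsAncestor T r u x ∧ IsAncestor T r x w := by
  classical
  obtain ⟨p, hp, hu⟩ := h
  have hq := hp.dropUntil hu
  have key : x ∈ treePath T u w ↔ x ∈ (p.dropUntil u hu).support := by
    refine ⟨fun ⟨q, hq', hx⟩ => ?_, fun hx => ⟨_, hq, hx⟩⟩
    rwa [(hT.existsUnique_path u w).unique hq hq']
  have hsplit : ∀ z, z ∈ p.support ↔ IsAncestor T r z u ∨ z ∈ (p.dropUntil u hu).support := by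
    intro z
    rw [isAncestor_iff_mem_support hT (hp.takeUntil hu),
      ← SimpleGraph.Walk.mem_support_append_iff, SimpleGraph.Walk.take_spec]
  rw [key, isAncestor_iff_mem_support hT hp]
  constructor
  · intro hx
    have hxp := (hsplit x).2 (Or.inr hx)
    refine ⟨?_, hxp⟩
    rcases IsAncestor.total hT ⟨p, hp, hxp⟩ ⟨p, hp, hu⟩ with h | h
    · by_cases hxu : x = u
      · exact hxu ▸ .refl hT x
      · have hpp : ((p.takeUntil u hu).append (p.dropUntil u hu)).IsPath := by
          rwa [SimpleGraph.Walk.take_spec]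
        exact absurd rfl (hpp.ne_of_mem_support_of_append hxu
          ((isAncestor_iff_mem_support hT (hp.takeUntil hu)).1 h) hx)
    · exact h
  · rintro ⟨h1, h2⟩
    rcases (hsplit x).1 h2 with h | h
    · rw [h1.antisymm hT h |>.symm]
      exact SimpleGraph.Walk.start_mem_support _
    · exact h

theorem mem_openTreePath_iff (hT : T.IsTree) (h : IsAncestor T r u w) :
    x ∈ openTreePath T u w ↔ IsAncestor T r u x ∧ IsAncestor T r x w ∧ x ≠ u ∧ x ≠ w := by
  rw [openTreePath, Set.mem_sdiff, mem_treePath_iff hT h]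
  simp only [Set.mem_insert_iff, Set.mem_singleton_iff, not_or, and_assoc]

/-- Induction along the tree path from `u` down to `w`. -/
theorem isAncestor_step_induction (hT : T.IsTree) {P : V → Prop} (h : IsAncestor T r u w)
    (hstep : ∀ x c, IsAncestor T r u x → IsChild T r c x → IsAncestor T r c w → P x → P c)
    (hu : P u) : P w := by
  induction w using tree_induction (r := r) hT with
  | hr => exact eq_root_of_isAncestor_root hT h ▸ hu
  | hc c p hc ih =>
    rcases (hc.isAncestor_iff hT).1 h with h' | rfl
    · exact hstep p c h' hc (.refl hT c) (ih h' fun x d hx hd hdp =>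
        hstep x d hx hd (hdp.trans hT hc.2))
    · exact hu

end TreeOrder

/-! ### Numberings, lowpoints and leftmost paths -/

section Numberings

variable {V : Type*} {G T : SimpleGraph V} {r : V} {num : V → ℕ}
  {a b c d l u v w x y : V}

theorem IsCompatible.injective (hnum : IsCompatible G T r num) : Function.Injective num :=
  fun _ _ h => hnum.bijOn.injOn (Set.mem_univ _) (Set.mem_univ _) h

theorem IsCompatible.pos (hnum : IsCompatible G T r num) (v : V) : 0 < num v :=
  (Set.mem_Icc.1 (hnum.bijOn.mapsTo (Set.mem_univ v))).1

theorem IsCompatible.isAncestor_iff (hnum : IsCompatible G T r num) :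
    IsAncestor T r v x ↔ num v ≤ num x ∧ num x ≤ num v + (Desc T r v).ncard - 1 := by
  rw [← Set.mem_Icc, ← hnum.desc_interval v, hnum.injective.mem_set_image]
  rfl

theorem IsCompatible.num_le (hnum : IsCompatible G T r num) (h : IsAncestor T r u v) :
    num u ≤ num v :=
  (hnum.isAncestor_iff.1 h).1

theorem IsCompatible.num_lt (hnum : IsCompatible G T r num) (h : IsAncestor T r u v)
    (hne : u ≠ v) : num u < num v :=
  lt_of_le_of_ne (hnum.num_le h) fun h' => hne (hnum.injective h')

theorem IsCompatible.isAncestor_of_num (hnum : IsCompatible G T r num) (h : IsAncestor T r u w)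
    (h1 : num u ≤ num x) (h2 : num x ≤ num w) : IsAncestor T r u x :=
  hnum.isAncestor_iff.2 ⟨h1, h2.trans (hnum.isAncestor_iff.1 h).2⟩

theorem IsCompatible.num_lt_of_not_isAncestor (hnum : IsCompatible G T r num)
    (hx : IsAncestor T r c x) (hcd : num c < num d) (h : ¬ IsAncestor T r c d) :
    num x < num d := by
  by_contra! hdx
  exact h (hnum.isAncestor_of_num hx hcd.le hdx)

theorem IsCompatible.isAncestor_of_num_le (hT : T.IsTree) (hnum : IsCompatible G T r num)
    (hu : IsAncestor T r u w) (hv : IsAncestor T r v w) (h : num u ≤ num v) :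
    IsAncestor T r u v := by
  rcases hu.total hT hv with h' | h'
  · exact h'
  · rw [hnum.injective (h.antisymm (hnum.num_le h'))]
    exact .refl hT v

theorem IsLeftChild.unique (hnum : IsCompatible G T r num) (hc : IsLeftChild T r num c v)
    (hd : IsLeftChild T r num d v) : c = d :=
  hnum.injective ((hd.2 c hc.1).antisymm (hc.2 d hd.1))

theorem IsLeftChild.leftChild_eq (hnum : IsCompatible G T r num) (h : IsLeftChild T r num c v) :
    leftChild T r num v = c := by
  have hex : ∃ c, IsLeftChild T r num c v := ⟨c, h⟩
  rw [leftChild, dif_pos hex]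
  exact hex.choose_spec.unique hnum h

theorem exists_isLeftChild [Finite V] (h : ¬ IsLeaf T r v) : ∃ c, IsLeftChild T r num c v := by
  simp only [IsLeaf, not_forall, not_not] at h
  obtain ⟨c, hc, hmax⟩ := Set.exists_max_image {c | IsChild T r c v} num (Set.toFinite _) h
  exact ⟨c, hc, hmax⟩

theorem IsLeftmostDesc.isAncestor (hT : T.IsTree) (h : IsLeftmostDesc T r num w v) :
    IsAncestor T r v w := by
  induction h with
  | refl => exact .refl hT v
  | tail _ hc ih => exact ih.trans hT hc.1.2

/-- Leftmost descendants come last in the numbering, so everything else below `v` precedes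
them. -/
theorem IsLeftmostDesc.num_lt (hT : T.IsTree) (hnum : IsCompatible G T r num)
    (h : IsLeftmostDesc T r num w v) (hvx : IsAncestor T r v x) (hwx : ¬ IsAncestor T r w x) :
    num x < num w := by
  induction h with
  | refl => exact absurd hvx hwx
  | @tail p q _ hq ih =>
    by_cases hpx : IsAncestor T r p x
    · by_cases hpx' : p = x
      · exact hpx' ▸ hnum.num_lt hq.1.2 hq.1.ne.symm
      obtain ⟨c, hc, hcx⟩ := exists_isChild_isAncestor hT hpx hpx'
      have hcq : c ≠ q := fun e => hwx (e ▸ hcx)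
      exact hnum.num_lt_of_not_isAncestor hcx
        (lt_of_le_of_ne (hq.2 c hc) fun e => hcq (hnum.injective e))
        fun e => hcq (hc.eq_of_isAncestor hT hq.1 e)
    · exact (ih hpx).trans_le (hnum.num_le hq.1.2)

/-! #### Lowpoints and highpoints -/

theorem IsChild.mem_lowSet (hT : IsNormalSpanningTree G T r) (h : IsChild T r c u) :
    u ∈ lowSet G T r c :=
  ⟨h.2, h.ne.symm, c, .refl hT.isTree c, hT.le h.1.symm⟩

theorem IsChild.isAncestor_of_mem_lowSet (hT : T.IsTree) (h : IsChild T r c u)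
    (hx : x ∈ lowSet G T r c) : IsAncestor T r x u :=
  ((h.isAncestor_iff hT).1 hx.1).resolve_right hx.2.1

/-- The definition of `lwpt` by choice does pick the lowest element of `L(c)`, which is nonempty
as it contains the parent of `c`. -/
theorem lwpt_one_spec [Finite V] (hT : IsNormalSpanningTree G T r) (hnum : IsCompatible G T r num)
    (hc : IsChild T r c u) :
    lwpt G T r 1 c ∈ lowSet G T r c ∧
      ∀ x ∈ lowSet G T r c, IsAncestor T r (lwpt G T r 1 c) x := by
  have hex : ∃ w ∈ lowSet G T r c, {x ∈ lowSet G T r c | IsAncestor T r x w}.ncard = 1 := by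
    obtain ⟨w, hw, hmin⟩ := Set.exists_min_image (lowSet G T r c) num (Set.toFinite _)
      ⟨u, hc.mem_lowSet hT⟩
    refine ⟨w, hw, Set.ncard_eq_one.2 ⟨w, Set.ext fun x => ⟨fun ⟨hx, hxw⟩ => ?_, ?_⟩⟩⟩
    · exact hnum.injective ((hnum.num_le hxw).antisymm (hmin x hx))
    · rintro rfl
      exact ⟨hw, .refl hT.isTree _⟩
  rw [lwpt, dif_pos hex]
  obtain ⟨hw, hcard⟩ := hex.choose_spec
  set w := hex.choose
  refine ⟨hw, fun x hx => ?_⟩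
  rcases hw.1.total hT.isTree hx.1 with h | h
  · exact h
  · obtain ⟨z, hz⟩ := Set.ncard_eq_one.1 hcard
    have h1 : x ∈ ({z} : Set V) := hz ▸ ⟨hx, h⟩
    have h2 : w ∈ ({z} : Set V) := hz ▸ ⟨hw, .refl hT.isTree _⟩
    rw [Set.mem_singleton_iff] at h1 h2
    rw [h1, ← h2]
    exact .refl hT.isTree _

/-- The second lowpoint of a child is its parent exactly when the parent is the second and
last element of the lowpoint set. -/
theorem lwpt_two_eq_parent_iff [Finite V] (hT : IsNormalSpanningTree G T r) (hc : IsChild T r c u) :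
    lwpt G T r 2 c = u ↔ (lowSet G T r c).ncard = 2 := by
  have hu : {x ∈ lowSet G T r c | IsAncestor T r x u} = lowSet G T r c :=
    Set.sep_eq_self_iff_mem_true.2 fun x hx => hc.isAncestor_of_mem_lowSet hT.isTree hx
  constructor
  · intro h
    rw [lwpt] at h
    split_ifs at h with hex
    · have := hex.choose_spec.2
      rwa [h, hu] at this
    · exact absurd h hc.ne
  · intro h
    have hex : ∃ w ∈ lowSet G T r c, {x ∈ lowSet G T r c | IsAncestor T r x w}.ncard = 2 :=
      ⟨u, hc.mem_lowSet hT, hu.symm ▸ h⟩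
    rw [lwpt, dif_pos hex]
    obtain ⟨hw, hcard⟩ := hex.choose_spec
    set w := hex.choose
    have heq : {x ∈ lowSet G T r c | IsAncestor T r x w} = lowSet G T r c :=
      Set.eq_of_subset_of_ncard_le (Set.sep_subset _ _) (by rw [hcard, h]) (Set.toFinite _)
    exact (hc.isAncestor_of_mem_lowSet hT.isTree hw).antisymm hT.isTree
      (heq.symm ▸ hc.mem_lowSet hT : u ∈ {x ∈ lowSet G T r c | IsAncestor T r x w}).2

theorem hgpt_spec [Finite V] (hT : T.IsTree) (hnum : IsCompatible G T r num) (hc : IsChild T r c u)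
    (hx : x ∈ lowSet G T r c) (hxu : x ≠ u) :
    hgpt G T r c ∈ lowSet G T r c ∧ hgpt G T r c ≠ u ∧
      ∀ z ∈ lowSet G T r c, z ≠ u → IsAncestor T r z (hgpt G T r c) := by
  obtain rfl := hc.parent_eq hT
  have hex : ∃ w ∈ lowSet G T r c \ {parent T r c},
      ∀ u ∈ lowSet G T r c \ {parent T r c}, IsAncestor T r u w := by
    obtain ⟨w, hw, hmax⟩ := Set.exists_max_image (lowSet G T r c \ {parent T r c}) num
      (Set.toFinite _) ⟨x, hx, hxu⟩
    exact ⟨w, hw, fun z hz => hnum.isAncestor_of_num_le hT hz.1.1 hw.1.1 (hmax z hz)⟩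
  have hspec := hex.choose_spec
  rw [hgpt, dif_pos hex]
  exact ⟨hspec.1.1, hspec.1.2, fun z hz hzu => hspec.2 z ⟨hz, hzu⟩⟩

theorem hgpt_eq_or_mem (hT : T.IsTree) (hc : IsChild T r c u) :
    hgpt G T r c = c ∨ hgpt G T r c ∈ lowSet G T r c ∧ hgpt G T r c ≠ u := by
  obtain rfl := hc.parent_eq hT
  rw [hgpt]
  split_ifs with hex
  · exact Or.inr hex.choose_spec.1
  · exact Or.inl rfl

/-! #### Leftmost paths and stability -/

variable (G T r) in
/-- Some edge of `G` joins a descendant of `c` to a proper ancestor of `u`. -/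
def ReachesAbove (c u : V) : Prop :=
  ∃ d y, IsAncestor T r c d ∧ G.Adj d y ∧ IsAncestor T r y u ∧ y ≠ u

variable (G T r) in
/-- No edge of `G` joins a vertex that lies below `u'` but not below `w` to a proper ancestor
of `u`. For a child `u'` of `u` with leftmost descendant `w`, this is stability of `T[u, w]`,
expressed without the numbering. -/
def NoEscape (u u' w : V) : Prop :=
  ∀ d y, IsAncestor T r u' d → ¬ IsAncestor T r w d → G.Adj d y → IsAncestor T r y u → y = u

theorem ReachesAbove.mono (hT : T.IsTree) (h : ReachesAbove G T r c u)
    (hx : IsAncestor T r x c) : ReachesAbove G T r x u := by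
  obtain ⟨d, y, hd, h⟩ := h
  exact ⟨d, y, hx.trans hT hd, h⟩

/-- The siblings are numbered by decreasing lowpoint, so a child whose subtree is the only one
with an edge to a proper ancestor of `u` is the left child. -/
theorem isLeftChild_of_reachesAbove [Finite V] (hT : IsNormalSpanningTree G T r)
    (hnum : IsCompatible G T r num) (hc : IsChild T r c v) (huv : IsAncestor T r u v)
    (h : ReachesAbove G T r c u)
    (hother : ∀ d, IsChild T r d v → d ≠ c → ¬ ReachesAbove G T r d u) :
    IsLeftChild T r num c v := by
  refine ⟨hc, fun c' hc' => ?_⟩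
  by_contra! hlt
  have hne : c' ≠ c := fun e => hlt.ne' (e ▸ rfl)
  have hle : num (lwpt G T r 1 c') ≤ num (lwpt G T r 1 c) := by
    have := hnum.siblings v c c' hc hc' hlt
    rw [pairLE, Prod.Lex.toLex_le_toLex] at this
    simp only at this
    omega
  obtain ⟨d, y, hd, hdy, hyu, hne'⟩ := h
  have hyv : IsAncestor T r y v := hyu.trans hT.isTree huv
  have hyc : y ≠ c := fun e => hc.not_isAncestor hT.isTree (e ▸ hyv)
  have h1 := hnum.num_le ((lwpt_one_spec hT hnum hc).2 y
    ⟨hyv.trans hT.isTree hc.2, hyc, d, hd, hdy⟩)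
  have h2 := hnum.num_lt hyu hne'
  obtain ⟨⟨hla, _, e, he, hadj⟩, -⟩ := lwpt_one_spec hT hnum hc'
  have hlu := hnum.isAncestor_of_num_le hT.isTree hla (huv.trans hT.isTree hc'.2) (by omega)
  exact hother c' hc' hne ⟨e, _, he, hadj, hlu, fun e => by rw [e] at hle; omega⟩

/-- If only vertices below `w` have edges to proper ancestors of `u`, then at each vertex of the
tree path from `u` to `w` the child on the path is the left child. -/
theorem isLeftChild_of_noEscape [Finite V] (hT : IsNormalSpanningTree G T r)
    (hnum : IsCompatible G T r num) (hc : IsChild T r c u) (hesc : NoEscape G T r u c w)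
    (hreach : ReachesAbove G T r w u) (hcx : IsAncestor T r c x) (hd : IsChild T r d x)
    (hdw : IsAncestor T r d w) : IsLeftChild T r num d x := by
  refine isLeftChild_of_reachesAbove hT hnum hd (hc.2.trans hT.isTree hcx)
    (hreach.mono hT.isTree hdw) fun d' hd' hne ⟨e, y, he, hey, hyu, hyne⟩ =>
    hyne (hesc e y (hcx.trans hT.isTree (hd'.2.trans hT.isTree he)) (fun hwe => ?_) hey hyu)
  exact hne (hd'.unique hT.isTree hd he (hdw.trans hT.isTree hwe))

theorem isLeftmostDesc_of_noEscape [Finite V] (hT : IsNormalSpanningTree G T r)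
    (hnum : IsCompatible G T r num) (hc : IsChild T r c u) (hesc : NoEscape G T r u c w)
    (hreach : ReachesAbove G T r w u) (hcx : IsAncestor T r c x) (hxw : IsAncestor T r x w) :
    IsLeftmostDesc T r num w x :=
  isAncestor_step_induction hT.isTree (P := fun z => IsLeftmostDesc T r num z x) hxw
    (fun _ _ hy hd hdw ih => ih.tail (isLeftChild_of_noEscape hT hnum hc hesc hreach
      (hcx.trans hT.isTree hy) hd hdw)) .refl

theorem not_adj_of_isAncestor_of_isChild (hT : T.IsTree) (hyu : IsAncestor T r y u)
    (hne : y ≠ u) (hc : IsChild T r c u) (hd : IsAncestor T r c d) : ¬ T.Adj d y := by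
  intro h
  have hud := hc.2.trans hT hd
  rcases isChild_or_isChild_of_adj (r := r) hT h with h | h
  · exact hc.not_isAncestor hT ((hd.trans hT h.2).trans hT hyu)
  · rcases (h.isAncestor_iff hT).1 hud with h' | rfl
    · exact hne (hyu.antisymm hT h')
    · exact hc.not_isAncestor hT hd

theorem isStable_of_noEscape (hT : IsNormalSpanningTree G T r)
    (hnum : IsCompatible G T r num) (hc : IsChild T r c u) (hcw : IsLeftmostDesc T r num w c)
    (hesc : NoEscape G T r u c w) : IsStable G T r num u w := by
  refine ⟨c, hc, hcw, fun x y ⟨hxy, _, hyx⟩ h1 h2 => ?_⟩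
  have hcx := hnum.isAncestor_of_num (hcw.isAncestor hT.isTree) h1 h2.le
  by_contra! hlt
  have hyu := hnum.isAncestor_of_num_le hT.isTree hyx (hc.2.trans hT.isTree hcx) hlt.le
  rw [hesc x y hcx (fun hwx => (hnum.num_le hwx).not_gt h2) hxy hyu] at hlt
  exact lt_irrefl _ hlt

theorem IsStable.exists_noEscape (hT : T.IsTree) (hnum : IsCompatible G T r num)
    (h : IsStable G T r num u w) :
    ∃ c, IsChild T r c u ∧ IsLeftmostDesc T r num w c ∧ NoEscape G T r u c w := by
  obtain ⟨c, hc, hcw, hst⟩ := h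
  refine ⟨c, hc, hcw, fun d y hcd hwd hdy hyu => ?_⟩
  by_contra hne
  have h1 := hst d y ⟨hdy, not_adj_of_isAncestor_of_isChild hT hyu hne hc hcd,
    hyu.trans hT (hc.2.trans hT hcd)⟩ (hnum.num_le hcd) (hcw.num_lt hT hnum hcd hwd)
  exact (hnum.num_lt hyu hne).not_ge h1

theorem le_stab (hnum : IsCompatible G T r num) (hx : IsAncestor T r x a)
    (h : IsStable G T r num x b) : num x ≤ stab G T r num a b := by
  refine le_csSup ⟨num a, ?_⟩ ⟨x, hx, h, rfl⟩
  rintro s ⟨z, hz, -, rfl⟩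
  exact hnum.num_le hz

theorem exists_num_eq_stab [Finite V] (h : 0 < stab G T r num a b) :
    ∃ x, IsAncestor T r x a ∧ IsStable G T r num x b ∧ num x = stab G T r num a b := by
  have hne : {s | ∃ x, IsAncestor T r x a ∧ IsStable G T r num x b ∧ num x = s}.Nonempty := by
    by_contra hne
    rw [Set.not_nonempty_iff_eq_empty] at hne
    simp [stab, hne] at h
  refine Nat.sSup_mem hne (Set.Finite.bddAbove ((Set.toFinite (Set.range num)).subset ?_))
  rintro s ⟨x, -, -, rfl⟩
  exact ⟨x, rfl⟩

theorem alpha_eq_stab (hT : T.IsTree) (hnum : IsCompatible G T r num) (hbu : IsChild T r b u)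
    (hl : IsLeftChild T r num l b) : alpha G T r num b = stab G T r num u l := by
  rw [alpha, if_neg (not_or.2 ⟨hbu.ne_root hT, fun h => h l hl.1⟩), hbu.parent_eq hT,
    hl.leftChild_eq hnum]

variable (G T r num) in
/-- The leftmost descendants of `l` among which `beta` picks the smallest one, where `l` is the
left child of `b`. -/
def betaCandidates (b l : V) : Set V :=
  {x | IsLeftmostDesc T r num x l ∧ (IsLeaf T r x ∨ ∃ c, IsLeftChild T r num c x ∧
    (num b ≤ num (lwpt G T r 1 c) ∨ num (hgpt G T r c) < num b))}

theorem beta_eq_sInf (hnum : IsCompatible G T r num) (hb : b ≠ r)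
    (hl : IsLeftChild T r num l b) :
    beta G T r num b = sInf (num '' betaCandidates G T r num b l) := by
  rw [beta, if_neg (not_or.2 ⟨hb, fun h => h l hl.1⟩), hl.leftChild_eq hnum]
  congr 1
  ext s
  exact ⟨fun ⟨x, h1, h2⟩ => ⟨x, h2, h1⟩, fun ⟨x, h2, h1⟩ => ⟨x, h1, h2⟩⟩

theorem beta_le (hnum : IsCompatible G T r num) (hb : b ≠ r) (hl : IsLeftChild T r num l b)
    (hx : x ∈ betaCandidates G T r num b l) : beta G T r num b ≤ num x := by
  rw [beta_eq_sInf hnum hb hl]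
  exact Nat.sInf_le ⟨x, hx, rfl⟩

theorem exists_num_eq_beta (hnum : IsCompatible G T r num) (hb : b ≠ r)
    (hl : IsLeftChild T r num l b) (h : (betaCandidates G T r num b l).Nonempty) :
    ∃ x ∈ betaCandidates G T r num b l, num x = beta G T r num b := by
  rw [beta_eq_sInf hnum hb hl]
  exact Nat.sInf_mem (h.image num)

theorem mem_betaCandidates_of_num_eq (hnum : IsCompatible G T r num) (hb : b ≠ r)
    (hl : IsLeftChild T r num l b) (hx : num x = beta G T r num b) :
    x ∈ betaCandidates G T r num b l := by
  by_cases hne : (betaCandidates G T r num b l).Nonempty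
  · obtain ⟨y, hy, hyx⟩ := exists_num_eq_beta hnum hb hl hne
    rwa [hnum.injective (hx.trans hyx.symm)]
  · rw [beta_eq_sInf hnum hb hl, Set.not_nonempty_iff_eq_empty.1 hne, Set.image_empty,
      Nat.sInf_empty] at hx
    exact absurd hx (hnum.pos x).ne'

end Numberings

/-! ### Separations and crossing -/

section Crossing

variable {V : Type*} {G : SimpleGraph V} {A B C D K : Set V} {a b c d x y z : V}

theorem IsSeparation.symm (h : IsSeparation G A B) : IsSeparation G B A :=
  ⟨Set.union_comm A B ▸ h.union_eq, h.right_nonempty, h.left_nonempty,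
    fun x hx y hy hxy => h.not_adj y hy x hx hxy.symm⟩

theorem IsSeparation.mem_of_adj (h : IsSeparation G A B) (hx : x ∈ A \ B) (hxy : G.Adj x y) :
    y ∈ A := by
  by_contra hy
  have : y ∈ A ∪ B := h.union_eq ▸ Set.mem_univ y
  exact h.not_adj x hx y ⟨this.resolve_left hy, hy⟩ hxy

theorem IsSeparation.mem_right (h : IsSeparation G A B) (hx : x ∉ A) : x ∈ B :=
  (h.union_eq ▸ Set.mem_univ x : x ∈ A ∪ B).resolve_left hx

theorem IsSeparation.mem_left (h : IsSeparation G A B) (hx : x ∉ B) : x ∈ A :=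
  h.symm.mem_right hx

theorem nested_comm : Nested B A C D ↔ Nested A B C D := by
  unfold Nested; tauto

theorem nested_comm_right : Nested A B D C ↔ Nested A B C D := by
  unfold Nested; tauto

theorem isCrossed_comm : IsCrossed G B A ↔ IsCrossed G A B := by
  simp only [IsCrossed, nested_comm]

/-- In a 2-connected graph, no single vertex `b` cuts off a set `K` from a vertex `z`. -/
theorem IsKConnected.exists_adj [Finite V] (hG : IsKConnected G 2) (hK : K.Nonempty)
    (hb : b ∉ K) (hz : z ∉ K) (hzb : z ≠ b) : ∃ x ∈ K, ∃ y ∉ K, y ≠ b ∧ G.Adj x y := by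
  by_contra! h
  refine hG.2 (insert b K) Kᶜ ⟨?_, ?_, ⟨z, hz, by simp [hz, hzb]⟩, ?_⟩ ?_
  · ext x; by_cases x ∈ K <;> simp [*]
  · obtain ⟨x, hx⟩ := hK
    exact ⟨x, Or.inr hx, fun h => h hx⟩
  · rintro x ⟨-, hx⟩ y ⟨hy, hy'⟩ hxy
    exact h x (not_not.1 hx) y hy (fun e => hy' (Or.inl e)) hxy
  · have : insert b K ∩ Kᶜ = {b} := by
      ext x; by_cases hx : x ∈ K
      · simp only [Set.mem_inter_iff, Set.mem_compl_iff, hx, Set.mem_singleton_iff]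
        simpa using fun e : x = b => hb (e ▸ hx)
      · simp [hx]
    rw [this]
    simp

/-- In a 2-connected graph, a set `K` whose neighbours outside `K` are among `a` and `b` is
attached to `a`, unless `K`, `a` and `b` cover everything. -/
theorem IsKConnected.exists_adj_left [Finite V] (hG : IsKConnected G 2) (hK : K.Nonempty)
    (hcl : ∀ x ∈ K, ∀ y, G.Adj x y → y ∈ K ∨ y = a ∨ y = b) (hb : b ∉ K) (hz : z ∉ K)
    (hzb : z ≠ b) : ∃ x ∈ K, G.Adj x a := by
  obtain ⟨x, hx, y, hy, hyb, hxy⟩ := hG.exists_adj hK hb hz hzb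
  rcases hcl x hx y hxy with h | rfl | h
  · exact absurd h hy
  · exact ⟨x, hx, hxy⟩
  · exact absurd h hyb

theorem IsSeparation.subset_of_connected (h : IsSeparation G C D) {X : Set V}
    (hX : (G.induce X).Connected) (hdisj : ∀ x ∈ X, x ∉ C ∩ D) :
    X ⊆ C \ D ∨ X ⊆ D \ C := by
  by_contra! hcon
  obtain ⟨⟨x, hx, hx'⟩, y, hy, hy'⟩ :=
    And.intro (Set.not_subset.1 hcon.1) (Set.not_subset.1 hcon.2)
  have hxD : x ∈ D \ C := by
    by_cases hxC : x ∈ C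
    · exact absurd ⟨hxC, fun hxD => hdisj x hx ⟨hxC, hxD⟩⟩ hx'
    · exact ⟨h.mem_right hxC, hxC⟩
  have hyC : y ∈ C \ D := by
    by_cases hyD : y ∈ D
    · exact absurd ⟨hyD, fun hyC => hdisj y hy ⟨hyC, hyD⟩⟩ hy'
    · exact ⟨h.mem_left hyD, hyD⟩
  obtain ⟨p⟩ := hX.preconnected ⟨y, hy⟩ ⟨x, hx⟩
  obtain ⟨e, -, h1, h2⟩ := p.exists_boundary_dart {z | z.1 ∈ C \ D} hyC
    (fun h' => hxD.2 h'.1)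
  have hadj : G.Adj e.fst.1 e.snd.1 := e.adj
  have hC := h.mem_of_adj h1 hadj
  exact h2 ⟨hC, fun hD => hdisj _ e.snd.2 ⟨hC, hD⟩⟩

/-- Each vertex of the separator of a 2-separation has a neighbour on each side, so a separation
for which one of these sides lies strictly on one side is nested with it. -/
theorem nested_of_subset [Finite V] (hG : IsKConnected G 2) (hAB : IsSeparation G A B)
    (hab : a ≠ b) (hsep : A ∩ B = {a, b}) (hCD : IsSeparation G C D) (h : A \ B ⊆ C \ D) :
    Nested A B C D := by
  have hmem : ∀ x, x ∈ A ∧ x ∈ B ↔ x = a ∨ x = b := fun x => by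
    rw [← Set.mem_inter_iff, hsep]; simp
  have hcl : ∀ x ∈ A \ B, ∀ y, G.Adj x y → y ∈ A \ B ∨ y = a ∨ y = b := by
    intro x hx y hxy
    have hyA := hAB.mem_of_adj hx hxy
    by_cases hyB : y ∈ B
    · exact Or.inr ((hmem y).1 ⟨hyA, hyB⟩)
    · exact Or.inl ⟨hyA, hyB⟩
  have ha := (hmem a).2 (Or.inl rfl)
  have hb := (hmem b).2 (Or.inr rfl)
  have haC : a ∈ C := by
    obtain ⟨x, hx, hxa⟩ := hG.exists_adj_left hAB.left_nonempty hcl (fun h => h.2 hb.2)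
      (fun h => h.2 ha.2) hab
    exact hCD.mem_of_adj (h hx) hxa
  have hbC : b ∈ C := by
    obtain ⟨x, hx, hxb⟩ := hG.exists_adj_left hAB.left_nonempty
      (fun x hx y hxy => (hcl x hx y hxy).imp_right Or.symm) (fun h => h.2 ha.2)
      (fun h => h.2 hb.2) hab.symm
    exact hCD.mem_of_adj (h hx) hxb
  refine Or.inl ⟨fun x hx => ?_, fun x hx => ?_⟩
  · by_cases hxB : x ∈ B
    · rcases (hmem x).1 ⟨hx, hxB⟩ with rfl | rfl
      exacts [haC, hbC]
    · exact (h ⟨hx, hxB⟩).1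
  · by_contra hxB
    exact (h ⟨hAB.mem_left hxB, hxB⟩).2 hx

/-- A 2-separation crossing a 2-separation `(A, B)` with `A \ B` connected has one vertex of its
separator strictly on each side of `(A, B)`. -/
theorem separator_sides_of_not_nested [Finite V] (hG : IsKConnected G 2) (hAB : IsSeparation G A B)
    (hab : a ≠ b) (hsep : A ∩ B = {a, b}) (hCD : IsTwoSeparation G C D)
    (hconn : (G.induce (A \ B)).Connected) (hcross : ¬ Nested A B C D) :
    ∃ c ∈ A \ B, ∃ d ∈ B \ A, C ∩ D = {c, d} := by
  obtain ⟨hCD, hcard⟩ := hCD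
  -- the connected side meets the separator, for otherwise it lies on one side
  have h1 : ∃ c ∈ A \ B, c ∈ C ∩ D := by
    by_contra! hdisj
    rcases hCD.subset_of_connected hconn hdisj with h | h
    · exact hcross (nested_of_subset hG hAB hab hsep hCD h)
    · exact hcross (nested_comm_right.1 (nested_of_subset hG hAB hab hsep hCD.symm h))
  obtain ⟨c, hc, hcCD⟩ := h1
  have hsep' : B ∩ A = {a, b} := Set.inter_comm A B ▸ hsep
  have hmem : ∀ x, x ∈ A ∧ x ∈ B ↔ x = a ∨ x = b := fun x => by
    rw [← Set.mem_inter_iff, hsep]; simp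
  have ha := (hmem a).2 (Or.inl rfl)
  have hb := (hmem b).2 (Or.inr rfl)
  -- the other side meets it too: otherwise a part of that side in `C` and a part in `D`
  -- would both be attached to `a` and `b`, forcing `C ∩ D = {a, b}`
  have h2 : ∃ d ∈ B \ A, d ∈ C ∩ D := by
    by_contra! hdisj
    have key : ∀ {C D : Set V}, IsSeparation G C D → (∀ x ∈ B \ A, x ∉ C ∩ D) →
        ((B \ A) ∩ C).Nonempty → a ∈ C ∧ b ∈ C := by
      intro C D hCD hdisj hne
      have hCD' : ∀ x ∈ (B \ A) ∩ C, x ∈ C \ D := fun x hx =>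
        ⟨hx.2, fun hD => hdisj x hx.1 ⟨hx.2, hD⟩⟩
      have hcl : ∀ x ∈ (B \ A) ∩ C, ∀ y, G.Adj x y → y ∈ (B \ A) ∩ C ∨ y = a ∨ y = b := by
        intro x hx y hxy
        have hyB := hAB.symm.mem_of_adj hx.1 hxy
        by_cases hyA : y ∈ A
        · exact Or.inr ((hmem y).1 ⟨hyA, hyB⟩)
        · exact Or.inl ⟨⟨hyB, hyA⟩, hCD.mem_of_adj (hCD' x hx) hxy⟩
      obtain ⟨x, hx, hxa⟩ := hG.exists_adj_left hne hcl (fun h => h.1.2 hb.1)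
        (fun h => h.1.2 ha.1) hab
      obtain ⟨y, hy, hyb⟩ := hG.exists_adj_left hne
        (fun x hx y hxy => (hcl x hx y hxy).imp_right Or.symm) (fun h => h.1.2 ha.1)
        (fun h => h.1.2 hb.1) hab.symm
      exact ⟨hCD.mem_of_adj (hCD' x hx) hxa, hCD.mem_of_adj (hCD' y hy) hyb⟩
    have hsub : ∀ {C D : Set V}, IsSeparation G C D → ¬ ((B \ A) ∩ D).Nonempty →
        B \ A ⊆ C \ D := by
      intro C D hCD hne x hx
      have hxD : x ∉ D := fun hxD => hne ⟨x, hx, hxD⟩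
      exact ⟨hCD.mem_left hxD, hxD⟩
    by_cases hC : ((B \ A) ∩ C).Nonempty
    · by_cases hD : ((B \ A) ∩ D).Nonempty
      · have h1 := key hCD hdisj hC
        have h2 := key hCD.symm (fun x hx h => hdisj x hx h.symm) hD
        have hsub : ({a, b} : Set V) ⊆ C ∩ D := by
          rintro x (rfl | rfl)
          exacts [⟨h1.1, h2.1⟩, ⟨h1.2, h2.2⟩]
        have heq := Set.eq_of_subset_of_ncard_le hsub
          (by rw [hcard, Set.ncard_pair hab]) (Set.toFinite _)
        rw [← heq, ← hsep] at hcCD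
        exact hc.2 hcCD.2
      · exact hcross (nested_comm.1
          (nested_of_subset hG hAB.symm hab hsep' hCD (hsub hCD hD)))
    · exact hcross (nested_comm.1 (nested_comm_right.1
        (nested_of_subset hG hAB.symm hab hsep' hCD.symm (hsub hCD.symm hC))))
  obtain ⟨d, hd, hdCD⟩ := h2
  refine ⟨c, hc, d, hd, (Set.eq_of_subset_of_ncard_le ?_ ?_ (Set.toFinite _)).symm⟩
  · rintro x (rfl | rfl)
    exacts [hcCD, hdCD]
  · rw [hcard, Set.ncard_pair (ne_of_mem_of_not_mem hc.1 hd.2)]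

/-- If the separator of `(C, D)` has one vertex strictly on each side of `(A, B)`, then `(C, D)`
separates the two vertices of the separator of `(A, B)`: otherwise a piece of `C \ D` or `D \ C`
would be cut off by a single vertex. -/
theorem not_both_mem_left [Finite V] (hG : IsKConnected G 2) (hAB : IsSeparation G A B)
    (hsep : A ∩ B = {a, b}) (hCD : IsSeparation G C D) (hc : c ∈ A \ B) (hd : d ∈ B \ A)
    (hcd : C ∩ D = {c, d}) : ¬ (a ∉ D ∧ b ∉ D) := by
  rintro ⟨ha, hb⟩
  have hmem : ∀ x, x ∈ A ∧ x ∈ B ↔ x = a ∨ x = b := fun x => by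
    rw [← Set.mem_inter_iff, hsep]; simp
  have hmem' : ∀ x, x ∈ C ∧ x ∈ D ↔ x = c ∨ x = d := fun x => by
    rw [← Set.mem_inter_iff, hcd]; simp
  have haA := (hmem a).2 (Or.inl rfl)
  have key : ∀ {A B : Set V} {c d : V}, IsSeparation G A B → c ∈ A \ B → d ∈ B \ A →
      (∀ x, x ∈ A ∧ x ∈ B ↔ x = a ∨ x = b) → (∀ x, x ∈ C ∧ x ∈ D ↔ x = c ∨ x = d) →
      ¬ ((D \ C) ∩ (A \ B)).Nonempty := by
    intro A B c d hAB hc hd hmem hmem' hne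
    obtain ⟨x, hx, y, hy, hyc, hxy⟩ := hG.exists_adj (b := c) (z := d) hne
      (fun h => h.1.2 ((hmem' c).2 (Or.inl rfl)).1) (fun h => hd.2 h.2.1)
      (fun e => hd.2 (e ▸ hc.1))
    have hyD := hCD.symm.mem_of_adj hx.1 hxy
    have hyA := hAB.mem_of_adj hx.2 hxy
    have hyB : y ∉ B := fun hyB => by
      rcases (hmem y).1 ⟨hyA, hyB⟩ with rfl | rfl
      exacts [ha hyD, hb hyD]
    have hyC : y ∈ C := by
      by_contra hyC
      exact hy ⟨⟨hyD, hyC⟩, hyA, hyB⟩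
    rcases (hmem' y).1 ⟨hyC, hyD⟩ with h | rfl
    · exact hyc h
    · exact hd.2 hyA
  obtain ⟨x, hx⟩ := hCD.right_nonempty
  by_cases hxB : x ∈ B
  · by_cases hxA : x ∈ A
    · rcases (hmem x).1 ⟨hxA, hxB⟩ with rfl | rfl
      exacts [ha hx.1, hb hx.1]
    · exact key hAB.symm hd hc (fun x => and_comm.trans (hmem x))
        (fun x => (hmem' x).trans or_comm) ⟨x, hx, hxB, hxA⟩
  · exact key hAB hc hd hmem hmem' ⟨x, hx, hAB.mem_left hxB, hxB⟩

/-- A half-connected 2-separation with separator `{a, b}` is crossed only by 2-separations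
that separate `a` from `b` and whose separator has a vertex strictly on each side. -/
theorem exists_crossing [Finite V] (hG : IsKConnected G 2) (hAB : IsSeparation G A B)
    (hab : a ≠ b) (hsep : A ∩ B = {a, b}) (hhalf : IsHalfConnected G A B)
    (hcross : IsCrossed G A B) :
    ∃ C D c d, IsSeparation G C D ∧ C ∩ D = {c, d} ∧ c ∈ A \ B ∧ d ∈ B \ A ∧
      a ∈ C \ D ∧ b ∈ D \ C := by
  obtain ⟨C, D, hCD, hn⟩ := hcross
  have h : ∃ c ∈ A \ B, ∃ d ∈ B \ A, C ∩ D = {c, d} := by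
    rcases hhalf with h | h
    · exact separator_sides_of_not_nested hG hAB hab hsep hCD h hn
    · obtain ⟨d, hd, c, hc, hcd⟩ := separator_sides_of_not_nested hG hAB.symm hab
        (Set.inter_comm A B ▸ hsep) hCD h (fun h' => hn (nested_comm.1 h'))
      exact ⟨c, hc, d, hd, hcd.trans (Set.pair_comm d c)⟩
  obtain ⟨c, hc, d, hd, hcd⟩ := h
  have hCD := hCD.1
  have hdc : D ∩ C = {c, d} := Set.inter_comm C D ▸ hcd
  have h1 := not_both_mem_left hG hAB hsep hCD hc hd hcd
  have h2 := not_both_mem_left hG hAB hsep hCD.symm hc hd hdc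
  have hout : ∀ x ∈ A ∩ B, x ∈ C → x ∉ D := by
    intro x hx hxC hxD
    have : x ∈ ({c, d} : Set V) := hcd ▸ ⟨hxC, hxD⟩
    rcases this with rfl | rfl
    exacts [hc.2 hx.2, hd.2 hx.1]
  have ha := hout a (hsep ▸ Or.inl rfl)
  have hb := hout b (hsep ▸ Or.inr rfl)
  by_cases haC : a ∈ C
  · have hbD : b ∈ D := by
      by_contra hbD
      exact h1 ⟨ha haC, hbD⟩
    exact ⟨C, D, c, d, hCD, hcd, hc, hd, ⟨haC, ha haC⟩, hbD, fun hbC => hb hbC hbD⟩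
  · have hbC : b ∈ C := by
      by_contra hbC
      exact h2 ⟨haC, hbC⟩
    exact ⟨D, C, c, d, hCD.symm, hdc, hc, hd, ⟨hCD.mem_right haC, haC⟩, hbC, hb hbC⟩

/-- Two vertices strictly on different sides of `(A, B)` that cut off some vertex set yield a
2-separation crossing `(A, B)`. -/
theorem isCrossed_of_closed (hc : c ∈ A \ B) (hd : d ∈ B \ A) (hx : x ∈ K)
    (hcK : c ∉ K) (hdK : d ∉ K) (hy : y ∉ K) (hyc : y ≠ c) (hyd : y ≠ d)
    (hcl : ∀ u ∈ K, ∀ v, G.Adj u v → v ∈ K ∨ v = c ∨ v = d) : IsCrossed G A B := by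
  have hcC : c ∈ K ∪ {c, d} := Or.inr (Or.inl rfl)
  have hdC : d ∈ K ∪ {c, d} := Or.inr (Or.inr rfl)
  refine ⟨K ∪ {c, d}, Kᶜ, ⟨⟨?_, ⟨x, Or.inl hx, fun h => h hx⟩, ⟨y, hy, ?_⟩, ?_⟩, ?_⟩, ?_⟩
  · ext z; by_cases z ∈ K <;> simp [*]
  · rintro (h | h | h)
    exacts [hy h, hyc h, hyd h]
  · rintro u ⟨-, hu⟩ v ⟨-, hv⟩ huv
    exact hv (hcl u (not_not.1 hu) v huv)
  · have : (K ∪ {c, d}) ∩ Kᶜ = {c, d} := by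
      ext z
      constructor
      · rintro ⟨h | h, hz⟩
        exacts [absurd h hz, h]
      · rintro (rfl | rfl)
        exacts [⟨hcC, hcK⟩, ⟨hdC, hdK⟩]
    rw [this]
    exact Set.ncard_pair (ne_of_mem_of_not_mem hc.1 hd.2)
  · rintro (h | h | h | h)
    · exact hc.2 (h.2 hcK)
    · exact hd.2 (h.2 hdK)
    · exact hc.2 (h.2 hcC)
    · exact hd.2 (h.2 hdC)

end Crossing

/-! ### Separations and normal spanning trees -/

section NormalTree

variable {V : Type*} {G T : SimpleGraph V} {r : V} {A B : Set V} {a a' b c d e l u v w x y z : V}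

theorem isChild_isAncestor_of_isAncestor (hT : T.IsTree) (hc : IsChild T r c u)
    (hcw : IsAncestor T r c w) (hux : IsAncestor T r u x) (hne : u ≠ x)
    (hxw : IsAncestor T r x w) : IsAncestor T r c x := by
  obtain ⟨d, hd, hdx⟩ := exists_isChild_isAncestor hT hux hne
  rwa [hc.unique hT hd hcw (hdx.trans hT hxw)]

theorem mem_lowSet_of_adj (hT : IsNormalSpanningTree G T r) (hd : IsAncestor T r c d)
    (hdy : G.Adj d y) (hy : ¬ IsAncestor T r c y) : y ∈ lowSet G T r c := by
  rcases hT.comparable d y hdy with h | h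
  · exact absurd (hd.trans hT.isTree h) hy
  · rcases h.total hT.isTree hd with h' | h'
    · exact ⟨h', fun e => hy (e ▸ .refl hT.isTree _), d, hd, hdy⟩
    · exact absurd h' hy

theorem ReachesAbove.exists_mem_lowSet (hT : T.IsTree) (h : ReachesAbove G T r c u)
    (huv : IsAncestor T r u v) (hc : IsChild T r c v) :
    ∃ y ∈ lowSet G T r c, IsAncestor T r y u ∧ y ≠ u := by
  obtain ⟨d, y, hd, hdy, hyu, hne⟩ := h
  have hyv := hyu.trans hT huv
  exact ⟨y, ⟨hyv.trans hT hc.2, fun e => hc.not_isAncestor hT (e ▸ hyv), d, hd, hdy⟩, hyu, hne⟩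

/-- In a 2-connected graph the subtree below a child of `u ≠ r` is not cut off by `u`. -/
theorem IsChild.reachesAbove [Finite V] (hG : IsKConnected G 2) (hT : IsNormalSpanningTree G T r)
    (hc : IsChild T r c u) (hu : u ≠ r) : ReachesAbove G T r c u := by
  obtain ⟨x, hx, y, hy, hyu, hxy⟩ := hG.exists_adj (K := Desc T r c) (b := u) (z := r)
    ⟨c, .refl hT.isTree c⟩ (hc.not_isAncestor hT.isTree)
    (fun h => hc.ne_root hT.isTree (eq_root_of_isAncestor_root hT.isTree h)) hu.symm
  exact ⟨x, y, hx, hxy, hc.isAncestor_of_mem_lowSet hT.isTree (mem_lowSet_of_adj hT hx hxy hy),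
    hyu⟩

theorem NoEscape.reachesAbove [Finite V] (hG : IsKConnected G 2)
    (hT : IsNormalSpanningTree G T r) (hc : IsChild T r c u) (hu : u ≠ r)
    (h : NoEscape G T r u c w) : ReachesAbove G T r w u := by
  obtain ⟨d, y, hd, hdy, hyu, hne⟩ := hc.reachesAbove hG hT hu
  refine ⟨d, y, ?_, hdy, hyu, hne⟩
  by_contra hwd
  exact hne (h d y hd hwd hdy hyu)

theorem NoEscape.mono (hT : T.IsTree) (h : NoEscape G T r u c w) (hx : IsAncestor T r x w) :
    NoEscape G T r u c x :=
  fun d y hd hxd => h d y hd fun hwd => hxd (hx.trans hT hwd)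

/-- A tree path that avoids the separator stays on one side of a separation. -/
theorem IsSeparation.mem_of_isAncestor (hT : IsNormalSpanningTree G T r)
    (h : IsSeparation G A B) (hv : v ∈ A \ B) (hvw : IsAncestor T r v w)
    (hdisj : ∀ x, IsAncestor T r v x → IsAncestor T r x w → x ∉ A ∩ B) : w ∈ A \ B := by
  refine isAncestor_step_induction hT.isTree (P := fun z => z ∈ A \ B) hvw
    (fun x c hx hc hcw ih => ?_) hv
  have hcA := h.mem_of_adj ih (hT.le hc.1)
  exact ⟨hcA, fun hcB => hdisj c (hx.trans hT.isTree hc.2) hcw ⟨hcA, hcB⟩⟩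

theorem IsSeparation.mem_of_isAncestor' (hT : IsNormalSpanningTree G T r)
    (h : IsSeparation G A B) (hw : w ∈ A \ B) (hvw : IsAncestor T r v w)
    (hdisj : ∀ x, IsAncestor T r v x → IsAncestor T r x w → x ∉ A ∩ B) : v ∈ A \ B := by
  have hv := hdisj v (.refl hT.isTree v) hvw
  by_contra hvA
  have hvB : v ∈ B \ A := by
    by_cases hA : v ∈ A
    · exact absurd ⟨hA, fun hB => hv ⟨hA, hB⟩⟩ hvA
    · exact ⟨h.mem_right hA, hA⟩
  exact (h.symm.mem_of_isAncestor hT hvB hvw fun x h1 h2 h3 => hdisj x h1 h2 h3.symm).2 hw.1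

/-! ### Type-2 separations -/

variable (G T r A B a a' b) in
/-- A type-2 separation with separator `{a, b}`, normalised so that the root lies in `A \ B`.
Here `a` lies above `b` and `a'` is the child of `a` towards `b`; the vertices of `T(a, b)` are
those of `T[a', b]` other than `b`. -/
structure IsRootedTypeTwo : Prop where
  sep : IsSeparation G A B
  inter : A ∩ B = {a, b}
  root_mem : r ∈ A \ B
  child : IsChild T r a' a
  isAncestor : IsAncestor T r a' b
  ne : a' ≠ b
  path : ∀ x, IsAncestor T r a' x → IsAncestor T r x b → x ≠ b → x ∈ B \ A

namespace IsRootedTypeTwo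

theorem mem_and_iff (h : IsRootedTypeTwo G T r A B a a' b) (x : V) :
    x ∈ A ∧ x ∈ B ↔ x = a ∨ x = b := by
  rw [← Set.mem_inter_iff, h.inter]; simp

theorem left_isAncestor (h : IsRootedTypeTwo G T r A B a a' b) (hT : T.IsTree) :
    IsAncestor T r a b :=
  h.child.2.trans hT h.isAncestor

theorem not_isAncestor_left (h : IsRootedTypeTwo G T r A B a a' b) (hT : T.IsTree)
    (hx : IsAncestor T r a' x) : ¬ IsAncestor T r x a :=
  fun h' => h.child.not_isAncestor hT (hx.trans hT h')

theorem left_mem (h : IsRootedTypeTwo G T r A B a a' b) : a ∈ A ∧ a ∈ B :=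
  (h.mem_and_iff a).2 (Or.inl rfl)

theorem right_mem (h : IsRootedTypeTwo G T r A B a a' b) : b ∈ A ∧ b ∈ B :=
  (h.mem_and_iff b).2 (Or.inr rfl)

theorem left_ne_root (h : IsRootedTypeTwo G T r A B a a' b) : a ≠ r :=
  fun e => h.root_mem.2 (e ▸ h.left_mem.2)

theorem right_ne_root (h : IsRootedTypeTwo G T r A B a a' b) : b ≠ r :=
  fun e => h.root_mem.2 (e ▸ h.right_mem.2)

theorem mem_openTreePath_iff (h : IsRootedTypeTwo G T r A B a a' b) (hT : T.IsTree) :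
    x ∈ openTreePath T a b ↔ IsAncestor T r a' x ∧ IsAncestor T r x b ∧ x ≠ b := by
  rw [TutteSep.mem_openTreePath_iff hT (h.left_isAncestor hT)]
  constructor
  · rintro ⟨h1, h2, h3, h4⟩
    exact ⟨isChild_isAncestor_of_isAncestor hT h.child h.isAncestor h1 h3.symm h2, h2, h4⟩
  · rintro ⟨h1, h2, h4⟩
    refine ⟨h.child.2.trans hT h1, h2, ?_, h4⟩
    rintro rfl
    exact h.child.not_isAncestor hT h1

theorem mem_of_isAncestor_left (h : IsRootedTypeTwo G T r A B a a' b)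
    (hT : IsNormalSpanningTree G T r) (hy : IsAncestor T r y a) (hne : y ≠ a) : y ∈ A \ B := by
  refine h.sep.mem_of_isAncestor hT h.root_mem (root_isAncestor hT.isTree y) fun x _ hxy hx => ?_
  rcases (h.mem_and_iff x).1 hx with rfl | rfl
  · exact hne (hy.antisymm hT.isTree hxy)
  · exact h.not_isAncestor_left hT.isTree h.isAncestor (hxy.trans hT.isTree hy)

/-- Everything below `T(a, b)`, except through `b`, lies strictly on the side of `T(a, b)`. -/
theorem mem_of_not_isAncestor_right (h : IsRootedTypeTwo G T r A B a a' b)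
    (hT : IsNormalSpanningTree G T r) (hx : IsAncestor T r a' x) (hbx : ¬ IsAncestor T r b x) :
    x ∈ B \ A := by
  refine h.sep.symm.mem_of_isAncestor hT (h.path a' (.refl hT.isTree a') h.isAncestor h.ne) hx
    fun z haz hzx hz => ?_
  rcases (h.mem_and_iff z).1 hz.symm with rfl | rfl
  · exact h.child.not_isAncestor hT.isTree haz
  · exact hbx hzx

theorem mem_of_isChild_right (h : IsRootedTypeTwo G T r A B a a' b)
    (hT : IsNormalSpanningTree G T r) (hl : IsChild T r l b) (hlA : l ∈ A \ B)
    (hd : IsAncestor T r l d) : d ∈ A \ B := by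
  refine h.sep.mem_of_isAncestor hT hlA hd fun z hz _ hzAB => ?_
  rcases (h.mem_and_iff z).1 hzAB with rfl | rfl
  · exact hl.not_isAncestor hT.isTree (hz.trans hT.isTree (h.left_isAncestor hT.isTree))
  · exact hl.not_isAncestor hT.isTree hz

theorem isAncestor_left_of_mem (h : IsRootedTypeTwo G T r A B a a' b) (hT : T.IsTree)
    (hz : z ∈ A) (hzb : IsAncestor T r z b) (hne : z ≠ b) : IsAncestor T r z a := by
  rcases hzb.total hT (h.left_isAncestor hT) with h' | h'
  · exact h'
  · by_cases hza : a = z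
    · exact hza ▸ .refl hT _
    · exact absurd hz (h.path z (isChild_isAncestor_of_isAncestor hT h.child h.isAncestor h' hza
        hzb) hzb hne).2

/-- `T(a, b)` is strictly on one side and the proper ancestors of `a` are strictly on the
other. -/
theorem noEscape (h : IsRootedTypeTwo G T r A B a a' b) (hT : IsNormalSpanningTree G T r) :
    NoEscape G T r a a' b := fun d y hd hbd hdy hya => by
  by_contra hne
  exact (h.mem_of_isAncestor_left hT hya hne).2
    (h.sep.symm.mem_of_adj (h.mem_of_not_isAncestor_right hT hd hbd) hdy)

variable [Finite V] {num : V → ℕ}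

theorem reachesAbove (h : IsRootedTypeTwo G T r A B a a' b) (hG : IsKConnected G 2)
    (hT : IsNormalSpanningTree G T r) : ReachesAbove G T r b a :=
  (h.noEscape hT).reachesAbove hG hT h.child h.left_ne_root

theorem isLeftChild_iff (h : IsRootedTypeTwo G T r A B a a' b) (hG : IsKConnected G 2)
    (hT : IsNormalSpanningTree G T r) (hnum : IsCompatible G T r num)
    (hx : IsAncestor T r a' x) (hxb : IsAncestor T r x b) (hne : x ≠ b) :
    IsLeftChild T r num c x ↔ IsChild T r c x ∧ IsAncestor T r c b := by
  have key : ∀ c, IsChild T r c x → IsAncestor T r c b → IsLeftChild T r num c x :=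
    fun c hc hcb => isLeftChild_of_noEscape hT hnum h.child (h.noEscape hT)
      (h.reachesAbove hG hT) hx hc hcb
  refine ⟨fun hc => ?_, fun hc => key c hc.1 hc.2⟩
  obtain ⟨d, hd, hdb⟩ := exists_isChild_isAncestor hT.isTree hxb hne
  rw [hc.unique hnum (key d hd hdb)]
  exact ⟨hd, hdb⟩

/-! ### Sufficiency of the three conditions -/

/-- If `L(c) = {y, x}` for the left child `c` of `x ∈ T(a, b)`, then `{y, x}` cuts off the
subtree below `c`. -/
theorem isCrossed_of_lwpt_two (h : IsRootedTypeTwo G T r A B a a' b) (hG : IsKConnected G 2)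
    (hT : IsNormalSpanningTree G T r) (hnum : IsCompatible G T r num)
    (hx : IsAncestor T r a' x) (hxb : IsAncestor T r x b) (hne : x ≠ b)
    (hc : IsLeftChild T r num c x) (hl : lwpt G T r 2 c = x) : IsCrossed G A B := by
  have hTt := hT.isTree
  obtain ⟨hcx, hcb⟩ := (h.isLeftChild_iff hG hT hnum hx hxb hne).1 hc
  have hax : IsAncestor T r a x := h.child.2.trans hTt hx
  obtain ⟨y, hy, hya, hyne⟩ := ((h.reachesAbove hG hT).mono hTt hcb).exists_mem_lowSet hTt hax hcx
  have hyx : y ≠ x := by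
    rintro rfl
    exact h.not_isAncestor_left hTt hx hya
  have hL : ({y, x} : Set V) = lowSet G T r c :=
    Set.eq_of_subset_of_ncard_le (by rintro z (rfl | rfl); exacts [hy, hcx.mem_lowSet hT])
      (by rw [(lwpt_two_eq_parent_iff hT hcx).1 hl, Set.ncard_pair hyx]) (Set.toFinite _)
  have hac : ∀ z, IsAncestor T r z x → ¬ IsAncestor T r c z := fun z hz hcz =>
    hcx.not_isAncestor hTt (hcz.trans hTt hz)
  refine isCrossed_of_closed (K := Desc T r c) (h.mem_of_isAncestor_left hT hya hyne)
    (h.path x hx hxb hne) (x := c) (y := a) (.refl hTt c) (hac y (hya.trans hTt hax))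
    (hac x (.refl hTt x)) (hac a hax) hyne.symm ?_ fun u hu v huv => ?_
  · rintro rfl
    exact h.not_isAncestor_left hTt hx (.refl hTt _)
  · by_cases hv : IsAncestor T r c v
    · exact Or.inl hv
    · have : v ∈ ({y, x} : Set V) := hL ▸ mem_lowSet_of_adj hT hu huv hv
      exact Or.inr this

/-- If the highpoint of the left child `c` of `x ∈ T(a, b)` is at most `s = stab(p(a), a')`,
then `{s, x}` cuts off the part of the tree between `s` and `c`. -/
theorem isCrossed_of_hgpt_le (h : IsRootedTypeTwo G T r A B a a' b) (hG : IsKConnected G 2)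
    (hT : IsNormalSpanningTree G T r) (hnum : IsCompatible G T r num)
    (hx : IsAncestor T r a' x) (hxb : IsAncestor T r x b) (hne : x ≠ b)
    (hc : IsLeftChild T r num c x)
    (hl : num (hgpt G T r c) ≤ stab G T r num (parent T r a) a') : IsCrossed G A B := by
  have hTt := hT.isTree
  obtain ⟨hcx, hcb⟩ := (h.isLeftChild_iff hG hT hnum hx hxb hne).1 hc
  have hax : IsAncestor T r a x := h.child.2.trans hTt hx
  obtain ⟨p, hp⟩ := exists_isChild_of_ne_root hTt h.left_ne_root
  rw [hp.parent_eq hTt] at hl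
  obtain ⟨s, hsp, hst, hs⟩ := exists_num_eq_stab ((hnum.pos _).trans_le hl)
  rw [← hs] at hl
  obtain ⟨s', hs', hleft, hesc⟩ := hst.exists_noEscape hTt hnum
  have hsa : IsAncestor T r s a := hsp.trans hTt hp.2
  have hsne : s ≠ a := by
    rintro rfl
    exact hp.not_isAncestor hTt hsp
  have hs'a : IsAncestor T r s' a := by
    refine ((h.child.isAncestor_iff hTt).1 (hleft.isAncestor hTt)).resolve_right ?_
    rintro rfl
    exact hsne (hs'.parent_unique hTt h.child)
  have hac : ∀ z, IsAncestor T r z x → ¬ IsAncestor T r c z := fun z hz hcz =>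
    hcx.not_isAncestor hTt (hcz.trans hTt hz)
  have hxa : x ≠ a := by
    rintro rfl
    exact h.not_isAncestor_left hTt hx (.refl hTt _)
  refine isCrossed_of_closed
    (K := {z | IsAncestor T r s' z ∧ ¬ IsAncestor T r c z ∧ z ≠ x})
    (h.mem_of_isAncestor_left hT hsa hsne) (h.path x hx hxb hne) (x := a) (y := b)
    ⟨hs'a, hac a hax, hxa.symm⟩ (fun hs => hs'.not_isAncestor hTt hs.1) (fun hx => hx.2.2 rfl)
    (fun hb => hb.2.1 hcb) ?_ hne.symm fun u hu v huv => ?_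
  · rintro rfl
    exact h.not_isAncestor_left hTt h.isAncestor hsa
  · by_contra! hcon
    obtain ⟨hvK, hvs, hvx⟩ := hcon
    obtain ⟨hs'u, hcu, hux⟩ := hu
    by_cases hcv : IsAncestor T r c v
    · have huL := mem_lowSet_of_adj hT hcv huv.symm hcu
      have h1 := hnum.num_le ((hgpt_spec hTt hnum hcx huL hux).2.2 u huL hux)
      have h2 := hnum.num_le hs'u
      have h3 := hnum.num_lt hs'.2 hs'.ne.symm
      omega
    · have hs'v : ¬ IsAncestor T r s' v := fun hs'v => hvK ⟨hs'v, hcv, hvx⟩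
      have hvs' := hs'.isAncestor_of_mem_lowSet hTt (mem_lowSet_of_adj hT hs'u huv hs'v)
      by_cases ha'u : IsAncestor T r a' u
      · refine (h.mem_of_isAncestor_left hT (hvs'.trans hTt hsa) ?_).2
          (h.sep.symm.mem_of_adj (h.mem_of_not_isAncestor_right hT ha'u fun hbu =>
            hcu (hcb.trans hTt hbu)) huv)
        rintro rfl
        exact hs'v hs'a
      · exact hvs (hesc u v hs'u ha'u huv hvs')

/-- A stable leftmost path `T[x, y]` with `x ∈ T(a, b)` and `y` strictly on the side of the root
cuts off the part of the tree between `x` and `y`, if the subtree below no child of `y` has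
neighbours both in this part and above `x`. -/
theorem isCrossed_of_stable (h : IsRootedTypeTwo G T r A B a a' b)
    (hT : IsNormalSpanningTree G T r) (hnum : IsCompatible G T r num)
    (hx : IsAncestor T r a' x) (hxb : IsAncestor T r x b) (hne : x ≠ b)
    (hy : y ∈ A \ B) (hby : IsAncestor T r b y)
    (hst : IsStable G T r num x y)
    (hch : ∀ c, IsChild T r c y →
      num x ≤ num (lwpt G T r 1 c) ∨ num (hgpt G T r c) ≤ num x) : IsCrossed G A B := by
  have hTt := hT.isTree
  obtain ⟨x', hx', hleft, hesc⟩ := hst.exists_noEscape hTt hnum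
  have hx'y := hleft.isAncestor hTt
  have hxy := hx'.2.trans hTt hx'y
  have hbyne : b ≠ y := fun e => hy.2 (e ▸ h.right_mem.2)
  have hyb : ¬ IsAncestor T r y b := fun h' => hbyne (hby.antisymm hTt h')
  have hax : IsAncestor T r a x := h.child.2.trans hTt hx
  refine isCrossed_of_closed (K := {d | IsAncestor T r x' d ∧ (¬ IsAncestor T r y d ∨
      ∃ e, IsChild T r e y ∧ IsAncestor T r e d ∧ ∀ z ∈ lowSet G T r e, IsAncestor T r x z)})
    hy (h.path x hx hxb hne) (x := b) (y := a)
    ⟨isChild_isAncestor_of_isAncestor hTt hx' hx'y hxb hne hby, Or.inl hyb⟩ ?_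
    (fun hx => hx'.not_isAncestor hTt hx.1)
    (fun ha => hx'.not_isAncestor hTt (ha.1.trans hTt hax)) ?_ ?_ ?_
  · rintro ⟨-, hyy | ⟨e, he, hey, -⟩⟩
    · exact hyy (.refl hTt y)
    · exact he.not_isAncestor hTt hey
  · rintro rfl
    exact hy.2 h.left_mem.2
  · rintro rfl
    exact h.not_isAncestor_left hTt hx (.refl hTt _)
  rintro u ⟨hx'u, hu⟩ v huv
  by_cases hcase : IsAncestor T r y u
  · obtain ⟨e, he, heu, heL⟩ := hu.resolve_left (not_not.2 hcase)
    by_cases hev : IsAncestor T r e v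
    · exact Or.inl ⟨hx'y.trans hTt (he.2.trans hTt hev), Or.inr ⟨e, he, hev, heL⟩⟩
    · have hvL := mem_lowSet_of_adj hT heu huv hev
      have hvy := he.isAncestor_of_mem_lowSet hTt hvL
      by_cases hvx : v = x
      · exact Or.inr (Or.inr hvx)
      by_cases hvy' : v = y
      · exact Or.inr (Or.inl hvy')
      · exact Or.inl ⟨isChild_isAncestor_of_isAncestor hTt hx' hx'y (heL v hvL) (Ne.symm hvx) hvy,
          Or.inl fun hyv => hvy' (hvy.antisymm hTt hyv)⟩
  · by_cases hx'v : IsAncestor T r x' v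
    · by_cases hyv : IsAncestor T r y v
      · by_cases hvy : y = v
        · exact Or.inr (Or.inl hvy.symm)
        obtain ⟨e, he, hev⟩ := exists_isChild_isAncestor hTt hyv hvy
        have huL := mem_lowSet_of_adj hT hev huv.symm fun heu =>
          hcase (he.2.trans hTt heu)
        refine Or.inl ⟨hx'v, Or.inr ⟨e, he, hev, fun z hz => ?_⟩⟩
        rcases hch e he with hch | hch
        · exact hnum.isAncestor_of_num_le hTt hxy (he.isAncestor_of_mem_lowSet hTt hz)
            (hch.trans (hnum.num_le ((lwpt_one_spec hT hnum he).2 z hz)))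
        · have huy : u ≠ y := fun e => hcase (e ▸ .refl hTt u)
          have h1 := hnum.num_le ((hgpt_spec hTt hnum he huL huy).2.2 u huL huy)
          have h2 := hnum.num_le hx'u
          have h3 := hnum.num_lt hx'.2 hx'.ne.symm
          omega
      · exact Or.inl ⟨hx'v, Or.inl hyv⟩
    · exact Or.inr (Or.inr (hesc u v hx'u hcase huv
        (hx'.isAncestor_of_mem_lowSet hTt (mem_lowSet_of_adj hT hx'u huv hx'v))))

end IsRootedTypeTwo
end NormalTree

/-! ### Necessity of the three conditions -/

section Necessity

variable {V : Type*} {G T : SimpleGraph V} {r : V} {num : V → ℕ} {A B C D : Set V}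
  {a a' b c d e l u v w x y z : V}

namespace IsRootedTypeTwo

/-- If `(C, D)` has separator `{c, x}` with `c` a proper ancestor of `a` and `x ∈ T(a, b)`, and
separates `a` from `b`, then `L(ℓ)`, for the left child `ℓ` of `x`, has no element strictly
between `c` and `x`. Either `L(ℓ) = {c, x}`, or `ℓ` also reaches above `c`, and then the part of
the tree between `c` and `x` cannot, so that `T[c, a']` is stable. -/
theorem exists_of_separator_above [Finite V] (h : IsRootedTypeTwo G T r A B a a' b)
    (hG : IsKConnected G 2)
    (hT : IsNormalSpanningTree G T r) (hnum : IsCompatible G T r num)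
    (hCD : IsSeparation G C D) (hcd : C ∩ D = {c, x}) (haC : a ∈ C \ D) (hbD : b ∈ D \ C)
    (hca : IsAncestor T r c a)
    (hx : IsAncestor T r a' x) (hxb : IsAncestor T r x b) :
    ∃ l, IsLeftChild T r num l x ∧
      (lwpt G T r 2 l = x ∨ num (hgpt G T r l) ≤ stab G T r num (parent T r a) a') := by
  have hTt := hT.isTree
  have hDC : D ∩ C = {c, x} := Set.inter_comm C D ▸ hcd
  have hmem : ∀ {z}, z ∈ C ∩ D → z = c ∨ z = x := fun {z} hz => by
    rw [hcd] at hz; exact hz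
  have hmem' : ∀ {z}, z ∈ D ∩ C → z = c ∨ z = x := fun hz => hmem hz.symm
  have hcC : c ∈ C ∩ D := hcd ▸ Or.inl rfl
  have hxC : x ∈ C ∩ D := hcd ▸ Or.inr rfl
  have hne : x ≠ b := fun e => hbD.2 (e ▸ hxC.1)
  have hcne : c ≠ a := fun e => haC.2 (e ▸ hcC.2)
  obtain ⟨l, hl, hlb⟩ := exists_isChild_isAncestor hTt hxb hne
  have hleft := (h.isLeftChild_iff hG hT hnum hx hxb hne).2 ⟨hl, hlb⟩
  have hax : IsAncestor T r a x := h.child.2.trans hTt hx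
  have hcx : IsAncestor T r c x := hca.trans hTt hax
  have hcxne : c ≠ x := by
    rintro rfl
    exact h.not_isAncestor_left hTt hx hca
  have hlz : ∀ z, IsAncestor T r l z → z ∉ D ∩ C := by
    intro z hz hzCD
    rcases hmem' hzCD with rfl | rfl
    · exact hl.not_isAncestor hTt (hz.trans hTt hcx)
    · exact hl.not_isAncestor hTt hz
  have hlD : l ∈ D \ C := hCD.symm.mem_of_isAncestor' hT hbD hlb fun z hz _ => hlz z hz
  have hbelow : ∀ z, IsAncestor T r l z → z ∈ D \ C := fun z hz =>
    hCD.symm.mem_of_isAncestor hT hlD hz fun z hz _ => hlz z hz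
  have hLD : ∀ z ∈ lowSet G T r l, z ∈ D := fun z ⟨_, _, d, hd, hdz⟩ =>
    hCD.symm.mem_of_adj (hbelow d hd) hdz
  -- the part of the tree between `c` and `x` is on the side of `a`
  obtain ⟨c', hc', hc'a⟩ := exists_isChild_isAncestor hTt hca hcne
  have hc'C : c' ∈ C \ D := by
    refine hCD.mem_of_isAncestor' hT haC hc'a fun z hz hza hzCD => ?_
    rcases hmem hzCD with rfl | rfl
    · exact hc'.not_isAncestor hTt hz
    · exact h.not_isAncestor_left hTt hx hza
  have hmid : ∀ z, IsAncestor T r c' z → ¬ IsAncestor T r x z → z ∈ C \ D := by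
    intro z hz hxz
    refine hCD.mem_of_isAncestor hT hc'C hz fun w hw hwz hwCD => ?_
    rcases hmem hwCD with rfl | rfl
    · exact hc'.not_isAncestor hTt hw
    · exact hxz hwz
  have hLc : ∀ z ∈ lowSet G T r l, z ≠ x → IsAncestor T r z c := by
    intro z hz hzx
    have hzx' := hl.isAncestor_of_mem_lowSet hTt hz
    rcases hzx'.total hTt hcx with h' | h'
    · exact h'
    by_cases hzc : c = z
    · exact hzc ▸ .refl hTt c
    have hc'z := isChild_isAncestor_of_isAncestor hTt hc' (hc'a.trans hTt hax) h' hzc hzx'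
    exact absurd (hLD z hz) (hmid z hc'z fun hxz => hzx (hzx'.antisymm hTt hxz)).2
  refine ⟨l, hleft, ?_⟩
  obtain ⟨y, hy, hya, hyne⟩ := ((h.reachesAbove hG hT).mono hTt hlb).exists_mem_lowSet hTt hax hl
  by_cases hex : ∃ z ∈ lowSet G T r l, z ≠ x ∧ z ≠ c
  · right
    obtain ⟨z, hz, hzx, hzc⟩ := hex
    have hspec := hgpt_spec hTt hnum hl hz hzx
    have hle := hnum.num_le (hLc _ hspec.1 hspec.2.1)
    refine hle.trans ?_
    obtain ⟨p, hp⟩ := exists_isChild_of_ne_root hTt h.left_ne_root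
    rw [hp.parent_eq hTt]
    refine le_stab hnum (((hp.isAncestor_iff hTt).1 hca).resolve_right hcne) ?_
    have hzc' := hLc z hz hzx
    have hzD : z ∈ D \ C := by
      refine ⟨hLD z hz, fun hzC => ?_⟩
      rcases hmem ⟨hzC, hLD z hz⟩ with h | h
      exacts [hzc h, hzx h]
    have hne_of : ∀ {u v w}, IsAncestor T r v w → IsAncestor T r w u → IsAncestor T r u c →
        u ≠ c → w ∉ D ∩ C := by
      intro u v w _ hwu huc huc' hw
      rcases hmem' hw with rfl | rfl
      · exact huc' (huc.antisymm hTt hwu)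
      · exact hcxne (hcx.antisymm hTt (hwu.trans hTt huc))
    have hesc : NoEscape G T r c c' a' := by
      intro d w hd had hdw hwc
      by_contra hwc'
      have hwD : w ∈ D \ C := by
        rcases hwc.total hTt hzc' with h' | h'
        · exact hCD.symm.mem_of_isAncestor' hT hzD h' fun t h1 h2 => hne_of h1 h2 hzc' hzc
        · exact hCD.symm.mem_of_isAncestor hT hzD h' fun t h1 h2 => hne_of h1 h2 hwc hwc'
      exact hwD.2 (hCD.mem_of_adj (hmid d hd fun hxd => had (hx.trans hTt hxd)) hdw)
    have hreach : ReachesAbove G T r a' c := by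
      obtain ⟨_, _, d, hd, hdz⟩ := hz
      exact ⟨d, z, hx.trans hTt (hl.2.trans hTt hd), hdz, hzc', hzc⟩
    have hc'a' := hc'a.trans hTt h.child.2
    exact isStable_of_noEscape hT hnum hc' (isLeftmostDesc_of_noEscape hT hnum hc' hesc hreach
      (.refl hTt c') hc'a') hesc
  · left
    push Not at hex
    have hyx : y ≠ x := by
      rintro rfl
      exact h.not_isAncestor_left hTt hx hya
    have hL : lowSet G T r l = {c, x} := by
      ext z
      constructor
      · intro hz
        by_cases hzx : z = x
        · exact Or.inr hzx
        · exact Or.inl (hex z hz hzx)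
      · rintro (rfl | rfl)
        · exact hex y hy hyx ▸ hy
        · exact hl.mem_lowSet hT
    rw [lwpt_two_eq_parent_iff hT hl, hL, Set.ncard_pair hcxne]

/-- If `(C, D)` has separator `{c, x}` with `x ∈ T(a, b)` and `c ∈ A \ B` not an ancestor of
`a`, and separates `a` from `b`, then `c` is a proper descendant of `b`, the part of the tree
between `x` and `c` has no edge to proper ancestors of `x`, and the subtree below a child of `c`
cannot have neighbours both in this part and above `x`. -/
theorem exists_of_separator_below [Finite V] (h : IsRootedTypeTwo G T r A B a a' b)
    (hG : IsKConnected G 2)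
    (hT : IsNormalSpanningTree G T r)
    (hCD : IsSeparation G C D) (hcd : C ∩ D = {c, x}) (haC : a ∈ C \ D) (hbD : b ∈ D \ C)
    (hcA : c ∈ A \ B) (hca : ¬ IsAncestor T r c a)
    (hx : IsAncestor T r a' x) (hxb : IsAncestor T r x b) :
    ∃ x' l, IsChild T r x' x ∧ IsAncestor T r x' b ∧ IsChild T r l b ∧ IsAncestor T r l c ∧
      NoEscape G T r x x' c ∧ ∀ e, IsChild T r e c →
        (∀ z ∈ lowSet G T r e, IsAncestor T r x z) ∨
        (∀ z ∈ lowSet G T r e, z ≠ c → IsAncestor T r z x) := by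
  have hTt := hT.isTree
  have hmem : ∀ {z}, z ∈ C ∩ D → z = c ∨ z = x := fun {z} hz => by
    rw [hcd] at hz; exact hz
  have hmem' : ∀ {z}, z ∈ D ∩ C → z = c ∨ z = x := fun hz => hmem hz.symm
  have hcC : c ∈ C ∩ D := hcd ▸ Or.inl rfl
  have hxC : x ∈ C ∩ D := hcd ▸ Or.inr rfl
  have hne : x ≠ b := fun e => hbD.2 (e ▸ hxC.1)
  have hcb : ¬ IsAncestor T r c b := fun hcb =>
    hca (h.isAncestor_left_of_mem hTt hcA.1 hcb fun e => hcA.2 (e ▸ h.right_mem.2))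
  have hax : IsAncestor T r a x := h.child.2.trans hTt hx
  have hrC : r ∈ C \ D := by
    refine hCD.mem_of_isAncestor' hT haC (root_isAncestor hTt a) fun z _ hza hz => ?_
    rcases hmem hz with rfl | rfl
    · exact hca hza
    · exact h.not_isAncestor_left hTt hx hza
  have habove : ∀ y, IsAncestor T r y x → y ≠ x → y ∈ C \ D := by
    intro y hyx hyne
    refine hCD.mem_of_isAncestor hT hrC (root_isAncestor hTt y) fun z _ hzy hz => ?_
    rcases hmem hz with rfl | rfl
    · exact hcb ((hzy.trans hTt hyx).trans hTt hxb)
    · exact hyne (hyx.antisymm hTt hzy)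
  have hbc : IsAncestor T r b c := by
    by_contra hbc
    obtain ⟨d, y, hd, hdy, hya, hyne⟩ := h.reachesAbove hG hT
    have hdD : d ∈ D \ C := by
      refine hCD.symm.mem_of_isAncestor hT hbD hd fun z hz _ hzCD => ?_
      rcases hmem' hzCD with rfl | rfl
      · exact hbc hz
      · exact hne (hxb.antisymm hTt hz)
    refine (habove y (hya.trans hTt hax) ?_).2 (hCD.symm.mem_of_adj hdD hdy)
    rintro rfl
    exact h.not_isAncestor_left hTt hx hya
  have hbne : b ≠ c := fun e => hcA.2 (e ▸ h.right_mem.2)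
  obtain ⟨l, hl, hlc⟩ := exists_isChild_isAncestor hTt hbc hbne
  obtain ⟨x', hx', hx'b⟩ := exists_isChild_isAncestor hTt hxb hne
  have hx'D : x' ∈ D \ C := by
    refine hCD.symm.mem_of_isAncestor' hT hbD hx'b fun z hz hzb hzCD => ?_
    rcases hmem' hzCD with rfl | rfl
    · exact hcb hzb
    · exact hx'.not_isAncestor hTt hz
  have hmid : ∀ e, IsAncestor T r x' e → ¬ IsAncestor T r c e → e ∈ D \ C := by
    intro e he hce
    refine hCD.symm.mem_of_isAncestor hT hx'D he fun z hz hze hzCD => ?_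
    rcases hmem' hzCD with rfl | rfl
    · exact hce hze
    · exact hx'.not_isAncestor hTt hz
  have hx'c := hx'b.trans hTt hbc
  have hxc := hxb.trans hTt hbc
  refine ⟨x', l, hx', hx'b, hl, hlc, fun d y hd hcd' hdy hyx => ?_, fun e he => ?_⟩
  · by_contra hyne
    exact (habove y hyx hyne).2 (hCD.symm.mem_of_adj (hmid d hd hcd') hdy)
  have hez : ∀ z, IsAncestor T r e z → z ∉ C ∩ D := by
    intro z hz hzCD
    rcases hmem hzCD with rfl | rfl
    · exact he.not_isAncestor hTt hz
    · exact he.not_isAncestor hTt (hz.trans hTt hxc)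
  by_cases heC : e ∈ C
  · right
    have heCD : e ∈ C \ D := ⟨heC, fun heD => hez e (.refl hTt e) ⟨heC, heD⟩⟩
    intro z hz hzc
    have hzc' := he.isAncestor_of_mem_lowSet hTt hz
    rcases hzc'.total hTt hxc with h' | h'
    · exact h'
    by_cases hzx : x = z
    · exact hzx ▸ .refl hTt x
    have hzD := hmid z (isChild_isAncestor_of_isAncestor hTt hx' hx'c h' hzx hzc')
      fun hcz => hzc (hzc'.antisymm hTt hcz)
    obtain ⟨_, _, d, hd, hdz⟩ := hz
    exact absurd (hCD.mem_of_adj (hCD.mem_of_isAncestor hT heCD hd fun z hz _ => hez z hz) hdz)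
      hzD.2
  · left
    have heDC : e ∈ D \ C := ⟨hCD.mem_right heC, heC⟩
    intro z hz
    rcases (he.isAncestor_of_mem_lowSet hTt hz).total hTt hxc with h' | h'
    · by_cases hzx : z = x
      · exact hzx ▸ .refl hTt z
      obtain ⟨_, _, d, hd, hdz⟩ := hz
      exact absurd (hCD.symm.mem_of_adj (hCD.symm.mem_of_isAncestor hT heDC hd
        fun z hz _ hz' => hez z hz hz'.symm) hdz) (habove z h' hzx).2
    · exact h'

/-- A pair `{x, c}` as in `exists_of_separator_below` can be replaced by `{alpha b, beta b}`.
By maximality of `alpha b` and minimality of `beta b`, these two lie between `x` and `c`. What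
makes the replacement work is that the subtree below `l` is strictly on the side of the root, so
that it has no neighbour in `T(a, b)`. -/
theorem exists_alpha_beta [Finite V] (h : IsRootedTypeTwo G T r A B a a' b) (hG : IsKConnected G 2)
    (hT : IsNormalSpanningTree G T r) (hnum : IsCompatible G T r num) {x' : V}
    (hcA : c ∈ A \ B) (hx : IsAncestor T r a' x) (hxb : IsAncestor T r x b)
    (hx' : IsChild T r x' x) (hx'b : IsAncestor T r x' b) (hl : IsChild T r l b)
    (hlc : IsAncestor T r l c) (hesc : NoEscape G T r x x' c)
    (hch : ∀ e, IsChild T r e c → (∀ z ∈ lowSet G T r e, IsAncestor T r x z) ∨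
        (∀ z ∈ lowSet G T r e, z ≠ c → IsAncestor T r z x)) :
    IsLeftChild T r num l b ∧ l ∈ A \ B ∧ num a < alpha G T r num b ∧
      ∃ x y : V, num x = alpha G T r num b ∧ num y = beta G T r num b ∧
        (∀ c, IsChild T r c y →
          num x ≤ num (lwpt G T r 1 c) ∨ num (hgpt G T r c) ≤ num x) ∧
        IsStable G T r num x y := by
  have hTt := hT.isTree
  have hbl := hl.2
  have hbc := hbl.trans hTt hlc
  have hx'l := hx'b.trans hTt hbl
  have hne : x ≠ b := by
    rintro rfl
    exact hx'.not_isAncestor hTt hx'b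
  have hax : IsAncestor T r a x := h.child.2.trans hTt hx
  have haxne : a ≠ x := by
    rintro rfl
    exact h.not_isAncestor_left hTt hx (.refl hTt _)
  have hxr : x ≠ r := by
    rintro rfl
    exact haxne (eq_root_of_isAncestor_root hTt hax)
  have hcr : c ≠ r := by
    rintro rfl
    exact hl.ne_root hTt (eq_root_of_isAncestor_root hTt hlc)
  have hlA : l ∈ A \ B := by
    refine h.sep.mem_of_isAncestor' hT hcA hlc fun z hz _ hzAB => ?_
    rcases (h.mem_and_iff z).1 hzAB with rfl | rfl
    · exact hl.not_isAncestor hTt (hz.trans hTt (h.left_isAncestor hTt))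
    · exact hl.not_isAncestor hTt hz
  have hreach := hesc.reachesAbove hG hT hx' hxr
  have hleft : IsLeftChild T r num l b :=
    isLeftChild_of_noEscape hT hnum hx' hesc hreach hx'b hl hlc
  have hcl : IsLeftmostDesc T r num c l :=
    isLeftmostDesc_of_noEscape hT hnum hx' hesc hreach hx'l hlc
  -- neighbours above `b` of the subtree below `l` are not in `T(a, b)`
  have hskip : ∀ {d z}, IsAncestor T r l d → G.Adj d z → IsAncestor T r z b → z ≠ b →
      IsAncestor T r z a := fun hd hdz hzb hzne =>
    h.isAncestor_left_of_mem hTt (h.sep.mem_of_adj (h.mem_of_isChild_right hT hl hlA hd) hdz)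
      hzb hzne
  have hskip' : ∀ {f z}, IsAncestor T r l f → z ∈ lowSet G T r f →
      IsAncestor T r z a ∨ IsAncestor T r b z := by
    intro f z hf hz
    rcases hz.1.total hTt (hbl.trans hTt hf) with h' | h'
    · by_cases hzb : z = b
      · exact Or.inr (hzb ▸ .refl hTt z)
      obtain ⟨_, _, d, hd, hdz⟩ := hz
      exact Or.inl (hskip (hf.trans hTt hd) hdz h' hzb)
    · exact Or.inr h'
  have hxa : ¬ IsAncestor T r x a := fun h' => haxne (hax.antisymm hTt h')
  obtain ⟨p, hp⟩ := exists_isChild_of_ne_root hTt h.right_ne_root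
  -- maximality of `alpha b`
  have halpha := alpha_eq_stab (G := G) hTt hnum hp hleft
  have hxst : IsStable G T r num x l := isStable_of_noEscape hT hnum hx'
    (isLeftmostDesc_of_noEscape hT hnum hx' (hesc.mono hTt hlc) (hreach.mono hTt hlc)
      (.refl hTt x') hx'l) (hesc.mono hTt hlc)
  have hxle := le_stab hnum (((hp.isAncestor_iff hTt).1 hxb).resolve_right hne) hxst
  obtain ⟨s, hsp, hst, hs⟩ := exists_num_eq_stab ((hnum.pos x).trans_le hxle)
  rw [← hs] at hxle halpha
  have hsb := hsp.trans hTt hp.2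
  have hxs := hnum.isAncestor_of_num_le hTt hxb hsb hxle
  have hsne : s ≠ b := by
    rintro rfl
    exact hp.not_isAncestor hTt hsp
  obtain ⟨s', hs', hls', hescs⟩ := hst.exists_noEscape hTt hnum
  -- minimality of `beta b`
  have hcand : c ∈ betaCandidates G T r num b l := by
    refine ⟨hcl, ?_⟩
    by_cases hleaf : IsLeaf T r c
    · exact Or.inl hleaf
    obtain ⟨e, he⟩ := exists_isLeftChild (num := num) hleaf
    refine Or.inr ⟨e, he, ?_⟩
    rcases hch e he.1 with h' | h'
    · left
      have hlw := (lwpt_one_spec hT hnum he.1).1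
      rcases hskip' (hlc.trans hTt he.1.2) hlw with h'' | h''
      · exact absurd ((h' _ hlw).trans hTt h'') hxa
      · exact hnum.num_le h''
    · right
      obtain ⟨z, hz, hzc, hzne⟩ := (he.1.reachesAbove hG hT hcr).exists_mem_lowSet hTt
        (.refl hTt c) he.1
      have hspec := hgpt_spec hTt hnum he.1 hz hzne
      exact (hnum.num_le (h' _ hspec.1 hspec.2.1)).trans_lt (hnum.num_lt hxb hne)
  obtain ⟨y, hy, hyb⟩ := exists_num_eq_beta hnum h.right_ne_root hleft ⟨c, hcand⟩
  have hyc : IsAncestor T r y c := by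
    by_contra hyc
    exact (hy.1.num_lt hTt hnum hlc hyc).not_ge
      (hyb.trans_le (beta_le hnum h.right_ne_root hleft hcand))
  have hly := hy.1.isAncestor hTt
  have hescy : NoEscape G T r s s' y := by
    intro d z hd hyd hdz hzs
    by_cases hld : IsAncestor T r l d
    · by_contra
      have hzb := hzs.trans hTt hsb
      have hza := hskip hld hdz hzb fun e => hsne (hsb.antisymm hTt (e ▸ hzs))
      have hzx := hesc d z (hx'l.trans hTt hld) (fun hcd => hyd (hyc.trans hTt hcd)) hdz
        (hza.trans hTt hax)
      exact hxa (hzx ▸ hza)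
    · exact hescs d z hd hld hdz hzs
  refine ⟨hleft, hlA, halpha ▸ (hnum.num_lt hax haxne).trans_le hxle, s, y, halpha.symm, hyb,
    fun f hf => ?_, isStable_of_noEscape hT hnum hs' (hls'.trans hy.1) hescy⟩
  have hlf := hly.trans hTt hf.2
  have hlw := lwpt_one_spec hT hnum hf
  have hnsb := hnum.num_le hsb
  by_cases hyc' : y = c
  · subst hyc'
    rcases hch f hf with h' | h'
    · left
      rcases hskip' hlf hlw.1 with h'' | h''
      · exact absurd ((h' _ hlw.1).trans hTt h'') hxa
      · exact hnsb.trans (hnum.num_le h'')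
    · right
      obtain ⟨z, hz, hzc, hzne⟩ := (hf.reachesAbove hG hT hcr).exists_mem_lowSet hTt
        (.refl hTt y) hf
      have hspec := hgpt_spec hTt hnum hf hz hzne
      exact (hnum.num_le (h' _ hspec.1 hspec.2.1)).trans hxle
  · by_cases hfc : IsAncestor T r f c
    · -- `f` is the left child of `y`, to which the choice of `beta b` applies
      have hfl : IsLeftChild T r num f y := isLeftChild_of_noEscape hT hnum hx' hesc hreach
        (hx'l.trans hTt hly) hf hfc
      obtain ⟨z, hz, hzx, hzne⟩ := (hreach.mono hTt hfc).exists_mem_lowSet hTt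
        (hx'.2.trans hTt (hx'l.trans hTt hly)) hf
      obtain ⟨e, he, hcase⟩ := hy.2.resolve_left fun hleaf => hleaf f hf
      rw [he.unique hnum hfl] at hcase
      rcases hcase with h' | h'
      · have h1 := hnum.num_le (hlw.2 z hz)
        have h2 := hnum.num_le hzx
        have h3 := hnum.num_lt hxb hne
        omega
      · right
        rcases hgpt_eq_or_mem (G := G) hTt hf with heq | hmem
        · have := hnum.num_le (hbl.trans hTt hlf)
          rw [heq] at h'
          omega
        · rcases hskip' hlf hmem.1 with h'' | h''
          · exact (hnum.num_le (h''.trans hTt hax)).trans hxle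
          · exact absurd (hnum.num_le h'') h'.not_ge
    · left
      rcases hskip' hlf hlw.1 with h' | h'
      · obtain ⟨_, _, d, hd, hdz⟩ := hlw.1
        have hcd : ¬ IsAncestor T r c d := fun hcd => by
          rcases hcd.total hTt hd with h1 | h1
          · rcases (hf.isAncestor_iff hTt).1 h1 with h2 | h2
            · exact hyc' (hyc.antisymm hTt h2)
            · exact hfc (h2 ▸ .refl hTt c)
          · exact hfc h1
        have := hesc d _ (hx'l.trans hTt (hlf.trans hTt hd)) hcd hdz (h'.trans hTt hax)
        exact absurd (this ▸ h') hxa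
      · exact hnsb.trans (hnum.num_le h')

/-! ### The criterion -/

theorem isCrossed_iff [Finite V] (h : IsRootedTypeTwo G T r A B a a' b) (hG : IsKConnected G 2)
    (hT : IsNormalSpanningTree G T r) (hnum : IsCompatible G T r num)
    (hhalf : IsHalfConnected G A B) :
    IsCrossed G A B ↔
      (∃ γ ∈ openTreePath T a b, ∃ l', IsLeftChild T r num l' γ ∧ lwpt G T r 2 l' = γ) ∨
      (∃ γ ∈ openTreePath T a b, ∃ l', IsLeftChild T r num l' γ ∧
        num (hgpt G T r l') ≤ stab G T r num (parent T r a) a') ∨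
      (¬ IsLeaf T r b ∧ ∃ l, IsLeftChild T r num l b ∧
        ¬ Separates A B l r ∧
        num a < alpha G T r num b ∧
        ∃ x y : V, num x = alpha G T r num b ∧ num y = beta G T r num b ∧
          (∀ c, IsChild T r c y →
            num x ≤ num (lwpt G T r 1 c) ∨ num (hgpt G T r c) ≤ num x) ∧
          IsStable G T r num x y) := by
  have hTt := hT.isTree
  have hab : a ≠ b := by
    rintro rfl
    exact h.child.not_isAncestor hTt h.isAncestor
  constructor
  · intro hcross
    obtain ⟨C, D, c, x, hCD, hcd, hcA, hxB, haC, hbD⟩ :=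
      exists_crossing hG h.sep hab h.inter hhalf hcross
    have hmem : ∀ {z}, z ∈ C ∩ D → z = c ∨ z = x := fun {z} hz => by
      rw [hcd] at hz; exact hz
    -- the path `T[a, b]` must meet the separator, and it does not contain `c`
    have hxp : IsAncestor T r a' x ∧ IsAncestor T r x b ∧ x ≠ b := by
      have hxb : x ≠ b := fun e => hxB.2 (e ▸ h.right_mem.1)
      by_contra hcon
      refine hbD.2 (hCD.mem_of_isAncestor hT haC (h.left_isAncestor hTt)
        fun z haz hzb hzCD => ?_).1
      have hza : z = a ∨ IsAncestor T r a' z := by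
        by_cases hza : z = a
        · exact Or.inl hza
        · exact Or.inr (isChild_isAncestor_of_isAncestor hTt h.child h.isAncestor haz
            (Ne.symm hza) hzb)
      rcases hmem hzCD with rfl | rfl
      · rcases hza with rfl | hza
        · exact hcA.2 h.left_mem.2
        · exact (h.path z hza hzb fun e => hcA.2 (e ▸ h.right_mem.2)).2 hcA.1
      · rcases hza with rfl | hza
        · exact hxB.2 h.left_mem.1
        · exact hcon ⟨hza, hzb, hxb⟩
    obtain ⟨hx, hxb, hxne⟩ := hxp
    have hγ := (h.mem_openTreePath_iff hTt).2 ⟨hx, hxb, hxne⟩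
    by_cases hca : IsAncestor T r c a
    · obtain ⟨l, hl, h' | h'⟩ :=
        h.exists_of_separator_above hG hT hnum hCD hcd haC hbD hca hx hxb
      · exact Or.inl ⟨x, hγ, l, hl, h'⟩
      · exact Or.inr (Or.inl ⟨x, hγ, l, hl, h'⟩)
    · obtain ⟨x', l, hx', hx'b, hl, hlc, hesc, hch⟩ :=
        h.exists_of_separator_below hG hT hCD hcd haC hbD hcA hca hx hxb
      obtain ⟨hleft, hlA, hlt, hxy⟩ :=
        h.exists_alpha_beta hG hT hnum hcA hx hxb hx' hx'b hl hlc hesc hch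
      refine Or.inr (Or.inr ⟨fun hleaf => hleaf l hl, l, hleft, ?_, hlt, hxy⟩)
      rintro (⟨-, hr⟩ | ⟨-, hl'⟩)
      · exact hr.2 h.root_mem.1
      · exact hl'.2 hlA.1
  · rintro (⟨γ, hγ, l, hl, h'⟩ | ⟨γ, hγ, l, hl, h'⟩ |
      ⟨-, l, hl, hsep, hlt, x, y, hxα, hyβ, hch, hst⟩)
    · obtain ⟨hx, hxb, hxne⟩ := (h.mem_openTreePath_iff hTt).1 hγ
      exact h.isCrossed_of_lwpt_two hG hT hnum hx hxb hxne hl h'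
    · obtain ⟨hx, hxb, hxne⟩ := (h.mem_openTreePath_iff hTt).1 hγ
      exact h.isCrossed_of_hgpt_le hG hT hnum hx hxb hxne hl h'
    · have hlA : l ∈ A \ B := by
        have hl1 : ¬ (l ∈ A ∧ l ∈ B) := fun hl' => by
          rcases (h.mem_and_iff l).1 hl' with rfl | rfl
          · exact hl.1.not_isAncestor hTt (h.left_isAncestor hTt)
          · exact hl.1.ne rfl
        have hlB : l ∉ B := fun hlB =>
          hsep (Or.inr ⟨h.root_mem, hlB, fun hlA => hl1 ⟨hlA, hlB⟩⟩)
        exact ⟨h.sep.mem_left hlB, hlB⟩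
      obtain ⟨p, hp⟩ := exists_isChild_of_ne_root hTt h.right_ne_root
      rw [alpha_eq_stab hTt hnum hp hl] at hlt hxα
      obtain ⟨s, hsp, -, hs⟩ := exists_num_eq_stab (Nat.zero_lt_of_lt hlt)
      obtain rfl : s = x := hnum.injective (hs.trans hxα.symm)
      have hsb := hsp.trans hTt hp.2
      have hsne : s ≠ b := by
        rintro rfl
        exact hp.not_isAncestor hTt hsp
      rw [← hs] at hlt
      have has := hnum.isAncestor_of_num_le hTt (h.left_isAncestor hTt) hsb hlt.le
      have hly := (mem_betaCandidates_of_num_eq hnum h.right_ne_root hl hyβ).1.isAncestor hTt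
      exact h.isCrossed_of_stable hT hnum
        (isChild_isAncestor_of_isAncestor hTt h.child h.isAncestor has
          (fun e => hlt.ne (congrArg num e)) hsb) hsb hsne
        (h.mem_of_isChild_right hT hl.1 hlA hly) (hl.1.2.trans hTt hly) hst hch

end IsRootedTypeTwo

theorem separates_comm : Separates B A x y ↔ Separates A B x y := by
  unfold Separates; tauto

theorem isHalfConnected_comm : IsHalfConnected G B A ↔ IsHalfConnected G A B :=
  or_comm

/-- In a type-2 separation, `a` is an ancestor of `b`: otherwise the parent of `a` lies in
`T(a, b)`, on the same side as the root. -/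
theorem isAncestor_of_isTypeTwo (hT : IsNormalSpanningTree G T r) (hnum : IsCompatible G T r num)
    (hAB : IsSeparation G A B) (hsep : A ∩ B = {a, b}) (hab : num a < num b)
    (hr : r ∈ A \ B) (hpath : openTreePath T a b ⊆ B \ A) : IsAncestor T r a b := by
  have hTt := hT.isTree
  by_contra hanc
  obtain ⟨p, hp⟩ := exists_isPath hTt a b
  obtain ⟨e, he, h1, h2⟩ := p.exists_boundary_dart {z | IsAncestor T r a z} (.refl hTt a) hanc
  have hsnd : e.snd ∈ p.support := p.dart_snd_mem_support_of_mem_darts he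
  obtain ⟨⟨x, y⟩, hxy⟩ := e
  have h1 : IsAncestor T r a x := h1
  have h2 : ¬ IsAncestor T r a y := h2
  rcases isChild_or_isChild_of_adj (r := r) hTt hxy with hc | hc
  · exact h2 (h1.trans hTt hc.2)
  obtain rfl : a = x := ((hc.isAncestor_iff hTt).1 h1).resolve_left h2
  have hyb : ¬ IsAncestor T r b y := fun h => (hnum.num_le (h.trans hTt hc.2)).not_gt hab
  have hyB : y ∈ B \ A := by
    refine hpath ⟨⟨p, hp, hsnd⟩, ?_⟩
    rintro (rfl | rfl)
    · exact hc.ne rfl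
    · exact hyb (.refl hTt _)
  refine hyB.2 (hAB.mem_of_isAncestor hT hr (root_isAncestor hTt y) fun z _ hzy hz => ?_).1
  rw [hsep] at hz
  rcases hz with rfl | rfl
  exacts [h2 hzy, hyb hzy]

theorem exists_isRootedTypeTwo (hT : IsNormalSpanningTree G T r) (hnum : IsCompatible G T r num)
    (hAB : IsSeparation G A B) (hsep : A ∩ B = {a, b}) (hab : num a < num b)
    (hne : (openTreePath T a b).Nonempty) (hr : r ∈ A \ B)
    (hpath : openTreePath T a b ⊆ B \ A) :
    ∃ a', IsRootedTypeTwo G T r A B a a' b := by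
  have hTt := hT.isTree
  have hanc := isAncestor_of_isTypeTwo hT hnum hAB hsep hab hr hpath
  obtain ⟨a', ha', ha'b⟩ := exists_isChild_isAncestor hTt hanc fun e => hab.ne (congrArg num e)
  refine ⟨a', hAB, hsep, hr, ha', ha'b, ?_, fun x hx hxb hxne => hpath ?_⟩
  · rintro rfl
    obtain ⟨x, hx⟩ := hne
    obtain ⟨h1, h2, h3, h4⟩ := (mem_openTreePath_iff hTt hanc).1 hx
    rcases (ha'.isAncestor_iff hTt).1 h2 with h | h
    exacts [h3 (h.antisymm hTt h1), h4 h]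
  · refine (mem_openTreePath_iff hTt hanc).2 ⟨ha'.2.trans hTt hx, hxb, ?_, hxne⟩
    rintro rfl
    exact ha'.not_isAncestor hTt hx

end Necessity

end TutteSep

theorem mainTheorem6 {V : Type*} [Finite V] (G T : SimpleGraph V) (r : V) (num : V → ℕ)
    (hG : IsKConnected G 2) (hT : IsNormalSpanningTree G T r)
    (hnum : IsCompatible G T r num)
    (A B : Set V) (a b : V) (hAB : IsTwoSeparation G A B)
    (hsep : A ∩ B = {a, b}) (hab : num a < num b)
    (hhalf : IsHalfConnected G A B) (htype : IsTypeTwo T r A B a b) :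
    (∃! a', IsChild T r a' a ∧ IsAncestor T r a' b) ∧
    ∀ a', IsChild T r a' a → IsAncestor T r a' b →
      (IsCrossed G A B ↔
        (∃ γ ∈ openTreePath T a b, ∃ l', IsLeftChild T r num l' γ ∧
          lwpt G T r 2 l' = γ) ∨
        (∃ γ ∈ openTreePath T a b, ∃ l', IsLeftChild T r num l' γ ∧
          num (hgpt G T r l') ≤ stab G T r num (parent T r a) a') ∨
        (¬ IsLeaf T r b ∧ ∃ l, IsLeftChild T r num l b ∧
          ¬ Separates A B l r ∧
          num a < alpha G T r num b ∧
          ∃ x y : V, num x = alpha G T r num b ∧ num y = beta G T r num b ∧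
            (∀ c, IsChild T r c y →
              num x ≤ num (lwpt G T r 1 c) ∨ num (hgpt G T r c) ≤ num x) ∧
            IsStable G T r num x y)) := by
  have hTt := hT.isTree
  obtain ⟨hAB, -⟩ := hAB
  obtain ⟨-, hne, hside⟩ := htype
  -- `A` and `B` are exchanged if necessary, so that the root lies in `A \ B`
  rcases hside with ⟨hr, hpath⟩ | ⟨hr, hpath⟩
  · obtain ⟨a', h⟩ := exists_isRootedTypeTwo hT hnum hAB hsep hab hne hr hpath
    refine ⟨⟨a', ⟨h.child, h.isAncestor⟩, fun c hc =>
      hc.1.unique hTt h.child hc.2 h.isAncestor⟩, fun c hc hcb => ?_⟩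
    rw [hc.unique hTt h.child hcb h.isAncestor]
    exact h.isCrossed_iff hG hT hnum hhalf
  · obtain ⟨a', h⟩ := exists_isRootedTypeTwo hT hnum hAB.symm (Set.inter_comm A B ▸ hsep) hab hne
      hr hpath
    refine ⟨⟨a', ⟨h.child, h.isAncestor⟩, fun c hc =>
      hc.1.unique hTt h.child hc.2 h.isAncestor⟩, fun c hc hcb => ?_⟩
    rw [hc.unique hTt h.child hcb h.isAncestor]
    have := h.isCrossed_iff hG hT hnum (isHalfConnected_comm.2 hhalf)
    simp only [isCrossed_comm, separates_comm] at this
    exact this
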